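/- For $n\ge 1$ and a permutation $\pi$ of $\mathbb{Z}/(2n+1)\mathbb{Z}=\{0,1,\dots,2n\}$, define the writhe of $\pi$ by $$w(\pi)=\sum_{i=0}^{2n}\sum_{j=1}^{n}\operatorname{sign}\bigl(\pi(i+j)-\pi(i)\bigr),$$ where $i+j$ is taken modulo $2n+1$ and the values of $\pi$ are compared as integers in $\{0,\dots,2n\}$; here $\operatorname{sign}(x)=+1$ if $x>0$ and $-1$ if $x<0$. Let $\pi_{2n+1}$ be a uniformly random permutation in $S_{2n+1}$. Then for every integer $k\ge 0$, $$E\left[\frac{w(\pi_{2n+1})^k}{n^k}\right]\;\xrightarrow[n\to\infty]{}\;\sum_{\sigma\in S_k}\;\prod_{\gamma\in\mathrm{cycles}(\sigma)}\lambda_{|\gamma|},$$ where the product runs over all cycles $\gamma$ of $\sigma$, fixed points being cycles of length $1$, $|\gamma|$ is the length of $\gamma$, $$\lambda_m=\frac{8^m(2^m-1)B_m^2}{2(m!)^2}\quad\text{for even } m,\qquad \lambda_m=0\quad\text{for odd } m,$$ and $B_m$ is the $m$-th Bernoulli number. -/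

import Mathlib

noncomputable section

/-- The writhe `∑_{i ∈ ℤ/(2n+1)} ∑_{j=1}^{n} sign (f (i+j) - f i)` of a function on the discrete
circle with `2n+1` points. -/
def circleWrithe (n : ℕ) (f : ZMod (2 * n + 1) → ℝ) : ℤ :=
  ∑ i : ZMod (2 * n + 1), ∑ j ∈ Finset.Icc 1 n,
    (SignType.sign (f (i + (j : ZMod (2 * n + 1))) - f i) : ℤ)

/-- The writhe of a permutation of `ℤ/(2n+1) = {0, …, 2n}`, whose values are compared as the
integers `0, …, 2n`. -/
def permWrithe (n : ℕ) (π : Equiv.Perm (ZMod (2 * n + 1))) : ℤ :=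
  circleWrithe n fun x => ((π x).val : ℝ)

/-- The expectation of a real function of a uniformly random element of a finite nonempty type. -/
def uniformExpectation {α : Type*} [Fintype α] [Nonempty α] (X : α → ℝ) : ℝ :=
  letI : MeasurableSpace α := ⊤
  ∫ a, X a ∂(PMF.uniformOfFintype α).toMeasure

/-- `8^m (2^m - 1) B_m² / (2 (m!)²)` for even `m`, and `0` for odd `m`. -/
def cycleWeight (m : ℕ) : ℝ :=
  if Even m then
    (8 : ℝ) ^ m * ((2 : ℝ) ^ m - 1) * (bernoulli m : ℝ) ^ 2 / (2 * (m.factorial : ℝ) ^ 2)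
  else 0

/-- The multiset of the lengths of all cycles of `σ`; a fixed point is a cycle of length `1`. -/
def cycleLengths {k : ℕ} (σ : Equiv.Perm (Fin k)) : Multiset ℕ :=
  σ.partition.parts

end

/-! Put `N = 2n+1`. The writhe is a randomly permuted bilinear sum `∑ A x y * B (π x) (π y)` with
two circulant kernels (`permWrithe_eq_permPairing`). For `B`, the sign of `v - u` minus the linear
term `2(v - u)/N` is a sawtooth in `v - u` mod `N`, and the linear term pairs to zero with the
square wave. For `A`, since the sawtooth is odd, the square wave may be replaced by the half of its
Fourier expansion supported on the frequencies `1, …, n`.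

The `k`-th power is a sum over labellings of the `2k` half-edges of `k` edges. The average over `π`
depends only on which labels coincide, so the moment is a sum over set partitions of the half-edges,
that is, over multigraphs with `k` edges and `V` vertices. Each contributes (injective sum of `A`) ·
(injective sum of `B`) / (falling factorial `N (N-1) ⋯ (N-V+1)`) (`sum_permPairing_pow`).

Rows and columns of both kernels sum to zero, so vertices of degree one can be merged away, and
every two of them save a factor `N` (`norm_injSum_le_of_leaves`). Hence every multigraph that is not
2-regular is smaller than the main order `N^k` by a factor `N`, up to powers of the bound `K = 1 +
log n` for the kernels. For 2-regular multigraphs, injective sums may be replaced by full sums at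
the same cost.

One-sidedness of the spectrum of `A` gives `∑ y, A y u * A y v = 0`, which kills each 2-regular
multigraph having a vertex that is twice a source. The survivors are the cycle graphs of
permutations `σ` of the edges (`sum_regularTerm`). There the Fourier expansion factors over the
cycles, a cycle of length `l` giving the product of the `l`-th power sums of the two sets of Fourier
coefficients (`fullSum_circ`).

Those coefficients tend to `2/(π i p)` for odd `p` (zero for even `p`) and to `1/(π i p)`. The power
sums therefore converge to zeta values at even `l`, giving `cycleWeight l / 2^l`; for odd `l` the
sawtooth sum cancels (`tendsto_powerSum_mul`). The powers of two come back from `N/n → 2`. -/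

/-! ### Sums over vertex labellings of a finite multigraph

A multigraph with edge set `ι` and vertex set `W` is given by a map `q : ι ⊕ ι → W`, where
`q (inl i)` is the source and `q (inr i)` the target of the edge `i`. -/

/-- The product of the entries of the kernel `M` over all edges, for labelled half-edges. -/
noncomputable def edgeProd {ι X : Type*} [Fintype ι] (M : X → X → ℂ) (f : ι ⊕ ι → X) : ℂ :=
  ∏ i, M (f (.inl i)) (f (.inr i))

/-- The sum of the edge products over all injective labellings of the vertices. -/
noncomputable def injSum {ι W X : Type*} [Fintype ι] [Fintype W] [Fintype X] [DecidableEq W] [DecidableEq X]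
    (M : X → X → ℂ) (q : ι ⊕ ι → W) : ℂ :=
  ∑ x : W ↪ X, edgeProd M (x ∘ q)

/-- The sum of the edge products over all labellings of the vertices. -/
noncomputable def fullSum {ι W X : Type*} [Fintype ι] [Fintype W] [Fintype X] [DecidableEq W]
    (M : X → X → ℂ) (q : ι ⊕ ι → W) : ℂ :=
  ∑ x : W → X, edgeProd M (x ∘ q)

/-- The degree of a vertex. -/
def fiberCard {S W : Type*} [Fintype S] [DecidableEq W] (q : S → W) (w : W) : ℕ :=
  (Finset.univ.filter fun s => q s = w).card

/-- The vertices of degree one. -/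
def leaves {S W : Type*} [Fintype S] [Fintype W] [DecidableEq W] (q : S → W) : Finset W :=
  Finset.univ.filter fun w => fiberCard q w = 1

theorem sum_fiberCard {S W : Type*} [Fintype S] [Fintype W] [DecidableEq W] (q : S → W) :
    ∑ w, fiberCard q w = Fintype.card S := by
  have := Finset.card_eq_sum_card_fiberwise (f := q) (s := Finset.univ) (t := Finset.univ)
    (by simp)
  simp only [fiberCard]
  rw [← this, Finset.card_univ]

theorem fiberCard_equiv {S W W' : Type*} [Fintype S] [DecidableEq W] [DecidableEq W']
    (e : W ≃ W') (q : S → W) (w : W) : fiberCard (e ∘ q) (e w) = fiberCard q w := by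
  simp [fiberCard]

theorem card_leaves_equiv {S W W' : Type*} [Fintype S] [Fintype W] [Fintype W'] [DecidableEq W]
    [DecidableEq W'] (e : W ≃ W') (q : S → W) : (leaves (e ∘ q)).card = (leaves q).card := by
  have : leaves (e ∘ q) = (leaves q).map e.toEmbedding := by
    ext w
    obtain ⟨w, rfl⟩ := e.surjective w
    simp [leaves, fiberCard_equiv]
  rw [this, Finset.card_map]

theorem norm_edgeProd_le {ι X : Type*} [Fintype ι] {M : X → X → ℂ} {K : ℝ}
    (hK : ∀ x y, ‖M x y‖ ≤ K) (f : ι ⊕ ι → X) : ‖edgeProd M f‖ ≤ K ^ Fintype.card ι := by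
  unfold edgeProd
  rw [norm_prod]
  refine (Finset.prod_le_prod (fun _ _ => norm_nonneg _) fun i _ => hK _ _).trans ?_
  simp

section

variable {ι W X : Type*} [Fintype ι] [Fintype W] [Fintype X] [DecidableEq W] [DecidableEq X]

theorem injSum_equiv {W' : Type*} [Fintype W'] [DecidableEq W'] (M : X → X → ℂ) (e : W ≃ W')
    (q : ι ⊕ ι → W) : injSum M (e ∘ q) = injSum M q := by
  unfold injSum
  refine Fintype.sum_equiv (Equiv.embeddingCongr e (Equiv.refl X)).symm _ _ fun x => ?_
  congr 1

theorem norm_injSum_le {M : X → X → ℂ} {K : ℝ} (hK : ∀ x y, ‖M x y‖ ≤ K) (q : ι ⊕ ι → W) :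
    ‖injSum M q‖ ≤
      K ^ Fintype.card ι * ((Fintype.card X).descFactorial (Fintype.card W) : ℕ) := by
  unfold injSum
  refine (norm_sum_le _ _).trans ?_
  refine (Finset.sum_le_sum fun x _ => norm_edgeProd_le hK _).trans ?_
  simp [Fintype.card_embedding_eq, mul_comm]

theorem norm_fullSum_le {ι W X : Type*} [Fintype ι] [Fintype W] [Fintype X] [DecidableEq W]
    {M : X → X → ℂ} {K : ℝ} (hK : ∀ x y, ‖M x y‖ ≤ K) (q : ι ⊕ ι → W) :
    ‖fullSum M q‖ ≤ K ^ Fintype.card ι * (Fintype.card X : ℝ) ^ Fintype.card W := by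
  unfold fullSum
  refine (norm_sum_le _ _).trans ?_
  refine (Finset.sum_le_sum fun x _ => norm_edgeProd_le hK _).trans ?_
  simp [mul_comm]

theorem norm_fullSum_sub_injSum_le {M : X → X → ℂ} {K : ℝ} (hK : ∀ x y, ‖M x y‖ ≤ K)
    (q : ι ⊕ ι → W) :
    ‖fullSum M q - injSum M q‖ ≤ K ^ Fintype.card ι *
      ((Fintype.card X : ℝ) ^ Fintype.card W -
        ((Fintype.card X).descFactorial (Fintype.card W) : ℕ)) := by
  classical
  set I : Finset (W → X) := Finset.univ.filter Function.Injective with hI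
  have hinj : injSum M q = ∑ x ∈ I, edgeProd M (x ∘ q) := by
    unfold injSum
    rw [hI, Finset.sum_subtype (p := Function.Injective) _ (by simp)]
    exact Fintype.sum_equiv (Equiv.subtypeInjectiveEquivEmbedding W X).symm _ _ fun x => rfl
  have hIc : I.card = (Fintype.card X).descFactorial (Fintype.card W) := by
    rw [← Fintype.card_embedding_eq, ← Fintype.card_congr (Equiv.subtypeInjectiveEquivEmbedding W X),
      Fintype.card_subtype]
  have hfull : fullSum M q - injSum M q = ∑ x ∈ Iᶜ, edgeProd M (x ∘ q) := by
    rw [hinj, fullSum, ← Finset.sum_add_sum_compl I]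
    ring
  rw [hfull]
  refine (norm_sum_le _ _).trans ?_
  refine (Finset.sum_le_sum fun x _ => norm_edgeProd_le hK _).trans ?_
  rw [Finset.sum_const, nsmul_eq_mul, mul_comm, Finset.card_compl, hIc,
    Nat.cast_sub (by rw [← hIc]; exact Finset.card_le_univ _)]
  simp

end

theorem sum_prod_eq_zero_of_factor {ι X : Type*} [Fintype ι] [DecidableEq ι] [Fintype X]
    (F : X → ι → ℂ) (i : ι) (hF : ∀ j, j ≠ i → ∀ y y', F y j = F y' j)
    (h0 : ∑ y, F y i = 0) : ∑ y, ∏ j, F y j = 0 := by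
  rcases isEmpty_or_nonempty X with hX | ⟨⟨y₀⟩⟩
  · simp
  have : ∀ y, ∏ j, F y j = F y i * ∏ j ∈ Finset.univ.erase i, F y₀ j := by
    intro y
    rw [← Finset.mul_prod_erase _ _ (Finset.mem_univ i)]
    congr 1
    exact Finset.prod_congr rfl fun j hj => hF j (Finset.ne_of_mem_erase hj) _ _
  simp_rw [this, ← Finset.sum_mul, h0, zero_mul]

section

variable {ι W X : Type*} [Fintype ι] [Fintype W] [Fintype X] [DecidableEq W] [DecidableEq X]

/-- Summing over the position of a vertex of degree one gives zero. -/
theorem sum_edgeProd_leaf {ι W X : Type*} [Fintype ι] [Fintype X] [DecidableEq W]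
    {M : X → X → ℂ} (hrow : ∀ x, ∑ y, M x y = 0)
    (hcol : ∀ y, ∑ x, M x y = 0) (q : ι ⊕ ι → Option W) (hq : fiberCard q none = 1) (x : W → X) :
    ∑ y, edgeProd M ((fun o : Option W => o.elim y x) ∘ q) = 0 := by
  classical
  obtain ⟨z, hz⟩ := Finset.card_eq_one.mp hq
  have hz' : ∀ s, q s = none ↔ s = z := by
    intro s
    have := Finset.ext_iff.mp hz s
    simpa using this
  -- Only the half-edge `z` sees `y`. In particular its edge is not a loop, so the product depends
  -- on `y` through a single kernel entry.
  have helim : ∀ s, s ≠ z → ∀ y y', (q s).elim y x = (q s).elim y' x := by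
    intro s hs y y'
    have : q s ≠ none := fun h => hs ((hz' s).mp h)
    obtain ⟨w, hw⟩ := Option.ne_none_iff_exists'.mp this
    simp [hw]
  have hzn : q z = none := (hz' z).mpr rfl
  unfold edgeProd
  rcases z with i | i
  · refine sum_prod_eq_zero_of_factor _ i (fun j hj y y' => ?_) ?_
    · simp only [Function.comp_apply]
      rw [helim _ (by simpa using hj) y y', helim (.inr j) (by simp) y y']
    · rcases isEmpty_or_nonempty X with hX | ⟨⟨y₀⟩⟩
      · simp
      simp only [Function.comp_apply, hzn, Option.elim_none]
      simp_rw [fun y => helim (.inr i) (by simp) y y₀]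
      exact hcol _
  · refine sum_prod_eq_zero_of_factor _ i (fun j hj y y' => ?_) ?_
    · simp only [Function.comp_apply]
      rw [helim _ (by simp) y y', helim (.inr j) (by simpa using hj) y y']
    · rcases isEmpty_or_nonempty X with hX | ⟨⟨y₀⟩⟩
      · simp
      simp only [Function.comp_apply, hzn, Option.elim_none]
      simp_rw [fun y => helim (.inl i) (by simp) y y₀]
      exact hrow _

/-- A vertex of degree one can be merged with the other vertices. -/
theorem injSum_merge {M : X → X → ℂ} (hrow : ∀ x, ∑ y, M x y = 0)
    (hcol : ∀ y, ∑ x, M x y = 0) (q : ι ⊕ ι → Option W) (hq : fiberCard q none = 1) :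
    injSum M q = - ∑ u : W, injSum M (fun s => (q s).getD u) := by
  classical
  have h1 : injSum M q = ∑ x : W ↪ X, ∑ y : ↥(Set.range x)ᶜ,
      edgeProd M ((fun o : Option W => o.elim (y : X) x) ∘ q) := by
    unfold injSum
    rw [← Fintype.sum_sigma' (fun (x : W ↪ X) (y : ↥(Set.range x)ᶜ) =>
      edgeProd M ((fun o : Option W => o.elim (y : X) x) ∘ q))]
    refine Fintype.sum_equiv (Function.Embedding.optionEmbeddingEquiv W X) _ _ fun x => ?_
    congr 1
    funext s
    simp only [Function.comp_apply]
    cases q s <;> rfl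
  have h2 : ∀ x : W ↪ X, ∑ y : ↥(Set.range x)ᶜ,
      edgeProd M ((fun o : Option W => o.elim (y : X) x) ∘ q) =
      - ∑ u : W, edgeProd M (x ∘ fun s => (q s).getD u) := by
    intro x
    -- The sum over all positions of the leaf vanishes. Positions off the range of `x` give the
    -- embeddings of `Option W`; a position on the range identifies the leaf with another vertex.
    have h0 := sum_edgeProd_leaf hrow hcol q hq x
    rw [← Fintype.sum_subtype_add_sum_subtype (fun y => y ∈ Set.range x)] at h0
    have h3 : ∑ y : {y // y ∈ Set.range x},
        edgeProd M ((fun o : Option W => o.elim (y : X) x) ∘ q) =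
        ∑ u : W, edgeProd M (x ∘ fun s => (q s).getD u) := by
      symm
      refine Fintype.sum_equiv (Equiv.ofInjective x x.injective) _ _ fun u => ?_
      congr 1
      funext s
      simp only [Function.comp_apply]
      cases q s <;> rfl
    rw [eq_neg_iff_add_eq_zero, add_comm, ← h3]
    convert h0
  rw [h1]
  simp_rw [h2, injSum]
  rw [Finset.sum_neg_distrib, Finset.sum_comm]

/-- Merging changes the degree of `u` only, so the only leaves that can be lost are the merged
vertex and `u` itself. -/
theorem card_leaves_le_merge {ι W : Type*} [Fintype ι] [Fintype W] [DecidableEq W] (q : ι ⊕ ι → Option W) (u : W) :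
    (leaves q).card ≤ (leaves fun s => (q s).getD u).card + 2 := by
  classical
  have hsub : leaves q ⊆ insert none (insert (some u)
      ((leaves fun s => (q s).getD u).map Function.Embedding.some)) := by
    intro o ho
    rcases o with _ | v
    · simp
    · by_cases hv : v = u
      · simp [hv]
      · simp only [leaves, Finset.mem_filter, Finset.mem_univ, true_and] at ho
        simp only [Finset.mem_insert, reduceCtorEq, Option.some.injEq, hv, false_or,
          Finset.mem_map, leaves, Finset.mem_filter, Finset.mem_univ, true_and]
        refine ⟨v, ?_, rfl⟩
        rw [← ho]
        unfold fiberCard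
        congr 1
        ext s
        simp only [Finset.mem_filter, Finset.mem_univ, true_and]
        cases q s with
        | none => simp [Ne.symm hv]
        | some a => simp
  refine (Finset.card_le_card hsub).trans ?_
  refine (Finset.card_insert_le _ _).trans ?_
  have := Finset.card_insert_le (some u)
      ((leaves fun s => (q s).getD u).map Function.Embedding.some)
  rw [Finset.card_map] at this
  omega

end

/-- The hypothesis on `e` says `e ≥ V - ⌈L/2⌉` with `L` the number of leaves. Each merge removes one
vertex and at most two leaves, which preserves it; when no leaf is left it reads `V ≤ e` and the
trivial bound suffices. The factorial counts the choices of the vertex merged into. -/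
theorem norm_injSum_le_of_leaves {ι X : Type*} [Fintype ι] [Fintype X] [DecidableEq X]
    [Nonempty X] {M : X → X → ℂ}
    {K : ℝ} (hK : ∀ x y, ‖M x y‖ ≤ K) (hrow : ∀ x, ∑ y, M x y = 0)
    (hcol : ∀ y, ∑ x, M x y = 0) (V : ℕ) :
    ∀ (W : Type) [Fintype W] [DecidableEq W] (q : ι ⊕ ι → W) (e : ℕ), Fintype.card W = V →
      2 * V ≤ 2 * e + (leaves q).card + 1 →
      ‖injSum M q‖ ≤ V.factorial * (K ^ Fintype.card ι * (Fintype.card X : ℝ) ^ e) := by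
  have hK0 : 0 ≤ K := (norm_nonneg _).trans (hK (Classical.arbitrary X) (Classical.arbitrary X))
  have hN : (1 : ℝ) ≤ Fintype.card X := by exact_mod_cast Fintype.card_pos
  induction V with
  | zero =>
    intro W _ _ q e hW _
    refine (norm_injSum_le hK q).trans ?_
    rw [hW]
    simp only [Nat.descFactorial_zero, Nat.cast_one, mul_one, Nat.factorial_zero, one_mul]
    exact le_mul_of_one_le_right (pow_nonneg hK0 _) (one_le_pow₀ hN)
  | succ V ih =>
    intro W _ _ q e hW hL
    have hfac : (1 : ℝ) ≤ (V + 1).factorial := by exact_mod_cast (V + 1).factorial_pos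
    have hpos : 0 ≤ K ^ Fintype.card ι * (Fintype.card X : ℝ) ^ e := by positivity
    by_cases hl : (leaves q).card = 0
    · refine (norm_injSum_le hK q).trans ?_
      refine le_trans ?_ (le_mul_of_one_le_left hpos hfac)
      refine mul_le_mul_of_nonneg_left ?_ (pow_nonneg hK0 _)
      have h1 : ((Fintype.card X).descFactorial (Fintype.card W) : ℝ) ≤
          (Fintype.card X : ℝ) ^ Fintype.card W := by
        exact_mod_cast Nat.descFactorial_le_pow _ _
      refine h1.trans (pow_le_pow_right₀ hN ?_)
      omega
    · obtain ⟨w, hw⟩ := Finset.card_pos.mp (Nat.pos_of_ne_zero hl)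
      set E := (Equiv.optionSubtypeNe w).symm with hE
      have hEw : E w = none := by simp [hE]
      have hdeg : fiberCard (E ∘ q) none = 1 := by
        rw [← hEw, fiberCard_equiv]
        simpa [leaves] using hw
      have hcard : Fintype.card {b // b ≠ w} = V := by
        have := Fintype.card_congr E
        rw [Fintype.card_option] at this
        omega
      rw [← injSum_equiv M E q, injSum_merge hrow hcol _ hdeg, norm_neg]
      refine (norm_sum_le _ _).trans ?_
      have hstep : ∀ u : {b // b ≠ w}, ‖injSum M (fun s => ((E ∘ q) s).getD u)‖ ≤
          V.factorial * (K ^ Fintype.card ι * (Fintype.card X : ℝ) ^ e) := by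
        intro u
        refine ih _ _ _ hcard ?_
        have h1 := card_leaves_le_merge (E ∘ q) u
        rw [card_leaves_equiv] at h1
        omega
      refine (Finset.sum_le_sum fun u _ => hstep u).trans ?_
      rw [Finset.sum_const, Finset.card_univ, hcard, nsmul_eq_mul, ← mul_assoc]
      refine mul_le_mul_of_nonneg_right ?_ hpos
      rw [Nat.factorial_succ]
      push_cast
      nlinarith [(Nat.cast_nonneg V.factorial : (0 : ℝ) ≤ V.factorial)]

/-- A surjective multigraph that is not 2-regular admits an exponent that is good for the bound on
both kernels at once. -/
theorem exists_exponent_of_not_regular {ι W : Type*} [Fintype ι] [Fintype W] [DecidableEq W]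
    (q : ι ⊕ ι → W) (hq : Function.Surjective q) (hreg : ¬ ∀ w, fiberCard q w = 2) :
    ∃ e : ℕ, 2 * Fintype.card W ≤ 2 * e + (leaves q).card + 1 ∧
      2 * e + 1 ≤ Fintype.card W + Fintype.card ι := by
  classical
  have hsum : ∑ w, fiberCard q w = 2 * Fintype.card ι := by
    rw [sum_fiberCard]
    simp [two_mul]
  have hpos : ∀ w, 1 ≤ fiberCard q w := by
    intro w
    obtain ⟨s, hs⟩ := hq w
    exact Finset.card_pos.mpr ⟨s, by simpa using hs⟩
  have hL : (leaves q).card = ∑ w, if fiberCard q w = 1 then 1 else 0 := by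
    rw [leaves, Finset.card_filter]
  have hle : ∀ w, 2 ≤ fiberCard q w + if fiberCard q w = 1 then 1 else 0 := by
    intro w
    have := hpos w
    split_ifs <;> omega
  have hV : 2 * Fintype.card W ≤ 2 * Fintype.card ι + (leaves q).card := by
    rw [← hsum, hL, ← Finset.sum_add_distrib]
    calc 2 * Fintype.card W = ∑ _w : W, 2 := by simp [mul_comm]
      _ ≤ _ := Finset.sum_le_sum fun w _ => hle w
  -- Without leaves all degrees are at least two and one is larger, so there are fewer vertices than
  -- edges and `e = V` works. With `L > 0` leaves the smallest admissible exponent `V - ⌈L/2⌉`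
  -- works, because `2V ≤ 2 * card ι + L`.
  rcases Nat.eq_zero_or_pos (leaves q).card with h0 | h0
  · have hlt : 2 * Fintype.card W < 2 * Fintype.card ι + (leaves q).card := by
      rw [← hsum, hL, ← Finset.sum_add_distrib]
      push Not at hreg
      obtain ⟨w₀, hw₀⟩ := hreg
      calc 2 * Fintype.card W = ∑ _w : W, 2 := by simp [mul_comm]
        _ < _ := Finset.sum_lt_sum (fun w _ => hle w) ⟨w₀, Finset.mem_univ _, by
          have h1 : w₀ ∉ leaves q := by
            rw [Finset.card_eq_zero.mp h0]; simp
          have h2 : fiberCard q w₀ ≠ 1 := by simpa [leaves] using h1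
          have := hpos w₀
          rw [if_neg h2]
          omega⟩
    exact ⟨Fintype.card W, by omega, by omega⟩
  · have hLW : (leaves q).card ≤ Fintype.card W := Finset.card_le_univ _
    exact ⟨Fintype.card W - ((leaves q).card + 1) / 2, by omega, by omega⟩

/-! ### Moments of a randomly permuted bilinear sum -/

noncomputable instance setoidFintype {S : Type*} [Finite S] : Fintype (Setoid S) :=
  have : Finite (Setoid S) :=
    Finite.of_injective (fun P : Setoid S => (P.r : S → S → Prop)) fun _ _ h =>
      Setoid.ext fun a b => iff_of_eq (congrFun (congrFun h a) b)
  Fintype.ofFinite _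

open Classical in
/-- The labellings whose equality pattern is the given equivalence relation. -/
noncomputable def withKer {S : Type*} (X : Type*) [Fintype S] [Fintype X] (P : Setoid S) :
    Finset (S → X) :=
  Finset.univ.filter fun f => Setoid.ker f = P

theorem mem_withKer {S X : Type*} [Fintype S] [Fintype X] {P : Setoid S} {f : S → X} :
    f ∈ withKer X P ↔ Setoid.ker f = P := by
  classical
  simp [withKer]

theorem ker_comp_of_injective {S W X : Type*} (q : S → W) {x : W → X}
    (hx : Function.Injective x) : Setoid.ker (x ∘ q) = Setoid.ker q :=
  Setoid.ext fun a b => by simp [Setoid.ker_def, hx.eq_iff]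

theorem sum_withKer_ker {S W X : Type*} [Fintype S] [Fintype W] [Fintype X] [DecidableEq W]
    [DecidableEq X] {R : Type*} [AddCommMonoid R] (G : (S → X) → R) {q : S → W}
    (hq : Function.Surjective q) :
    ∑ f ∈ withKer X (Setoid.ker q), G f = ∑ x : W ↪ X, G (x ∘ q) := by
  symm
  refine Finset.sum_bij (fun x _ => x ∘ q) (fun x _ => ?_) (fun x _ y _ h => ?_)
    (fun f hf => ?_) (fun _ _ => rfl)
  · exact mem_withKer.mpr (ker_comp_of_injective q x.injective)
  · ext w
    obtain ⟨s, rfl⟩ := hq w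
    exact congrFun h s
  · have hker := mem_withKer.mp hf
    have hiff : ∀ a b, f a = f b ↔ q a = q b := fun a b => by
      rw [← Setoid.ker_def, ← Setoid.ker_def, hker]
    refine ⟨⟨fun w => f (Function.surjInv hq w), fun w w' h => ?_⟩, Finset.mem_univ _, ?_⟩
    · have := (hiff _ _).mp h
      rwa [Function.surjInv_eq hq, Function.surjInv_eq hq] at this
    · funext s
      exact (hiff _ _).mpr (Function.surjInv_eq hq _)

/-- Equal kernels give a bijection between the two ranges, which extends to a permutation because
`X` is finite. -/
theorem exists_perm_comp_eq {S X : Type*} [Finite X] {f g : S → X}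
    (h : Setoid.ker f = Setoid.ker g) : ∃ ρ : Equiv.Perm X, ρ ∘ f = g := by
  classical
  have := Fintype.ofFinite X
  have hiff : ∀ a b, f a = f b ↔ g a = g b := fun a b => by
    rw [← Setoid.ker_def, ← Setoid.ker_def, h]
  let φ : Set.range f → X := fun y => g y.2.choose
  have hφ : ∀ s, φ ⟨f s, s, rfl⟩ = g s := fun s =>
    (hiff _ _).mp (Exists.choose_spec (⟨s, rfl⟩ : ∃ t, f t = f s))
  have hinj : Function.Injective φ := by
    rintro ⟨_, a, rfl⟩ ⟨_, b, rfl⟩ hab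
    rw [hφ, hφ] at hab
    exact Subtype.ext ((hiff _ _).mpr hab)
  let e : Set.range f ≃ Set.range φ := Equiv.ofInjective φ hinj
  refine ⟨e.extendSubtype, funext fun s => ?_⟩
  have := e.extendSubtype_apply_of_mem (f s) ⟨s, rfl⟩
  simp only [Function.comp_apply]
  rw [this]
  exact hφ s

section

variable {S X : Type*} [Fintype S] [Fintype X] [DecidableEq X]

theorem sum_perm_comp_of_ker_eq {S X : Type*} [Fintype X] [DecidableEq X] (b : (S → X) → ℂ) {f g : S → X}
    (h : Setoid.ker f = Setoid.ker g) :
    ∑ π : Equiv.Perm X, b (π ∘ f) = ∑ π : Equiv.Perm X, b (π ∘ g) := by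
  obtain ⟨ρ, rfl⟩ := exists_perm_comp_eq h
  exact (Fintype.sum_equiv (Equiv.mulRight ρ) _ _ fun π => rfl).symm

/-- For random `π`, the labelling `π ∘ f` is uniform among those with the pattern of `f`. This is a
double count: the permutation sum is the same for every `f` in the class, and each `π` permutes the
class. -/
theorem card_withKer_mul_sum_perm (b : (S → X) → ℂ) (f : S → X) :
    ((withKer X (Setoid.ker f)).card : ℂ) * ∑ π : Equiv.Perm X, b (π ∘ f) =
      (Fintype.card (Equiv.Perm X) : ℂ) * ∑ g ∈ withKer X (Setoid.ker f), b g := by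
  have h1 : ∀ π : Equiv.Perm X, ∑ g ∈ withKer X (Setoid.ker f), b (π ∘ g) =
      ∑ g ∈ withKer X (Setoid.ker f), b g := by
    intro π
    refine Finset.sum_bij (fun g _ => π ∘ g) (fun g hg => ?_) (fun g _ g' _ h => ?_)
      (fun g hg => ⟨π.symm ∘ g, ?_, ?_⟩) (fun _ _ => rfl)
    · rw [mem_withKer] at hg ⊢
      rw [ker_comp_of_injective _ π.injective, hg]
    · exact π.injective.comp_left h
    · rw [mem_withKer] at hg ⊢
      rw [ker_comp_of_injective _ π.symm.injective, hg]
    · funext s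
      simp
  calc ((withKer X (Setoid.ker f)).card : ℂ) * ∑ π : Equiv.Perm X, b (π ∘ f)
      = ∑ g ∈ withKer X (Setoid.ker f), ∑ π : Equiv.Perm X, b (π ∘ g) := by
        rw [Finset.sum_congr rfl fun g hg =>
          sum_perm_comp_of_ker_eq b (mem_withKer.mp hg), Finset.sum_const, nsmul_eq_mul]
    _ = _ := by
        rw [Finset.sum_comm]
        simp_rw [h1]
        rw [Finset.sum_const, nsmul_eq_mul, Finset.card_univ]

/-- The expectation over a random permutation of a bilinear expression, sorted by the equality
pattern of the labels. -/
theorem sum_mul_sum_perm [DecidableEq S] (a b : (S → X) → ℂ) :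
    ∑ f : S → X, a f * ∑ π : Equiv.Perm X, b (π ∘ f) =
      (Fintype.card (Equiv.Perm X) : ℂ) * ∑ P : Setoid S,
        (∑ f ∈ withKer X P, a f) * (∑ f ∈ withKer X P, b f) / ((withKer X P).card : ℂ) := by
  classical
  rw [← Finset.sum_fiberwise (s := Finset.univ) (g := fun f : S → X => Setoid.ker f),
    Finset.mul_sum]
  refine Finset.sum_congr rfl fun P _ => ?_
  have hw : (Finset.univ.filter fun f : S → X => Setoid.ker f = P) = withKer X P := by
    ext f; simp [mem_withKer]
  rw [hw]
  have h1 : ∀ f ∈ withKer X P, a f * ∑ π : Equiv.Perm X, b (π ∘ f) =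
      a f * ((Fintype.card (Equiv.Perm X) : ℂ) * (∑ g ∈ withKer X P, b g) /
        ((withKer X P).card : ℂ)) := by
    intro f hf
    have hne : ((withKer X P).card : ℂ) ≠ 0 := by
      exact_mod_cast (Finset.card_pos.mpr ⟨f, hf⟩).ne'
    have h2 := card_withKer_mul_sum_perm b f
    rw [mem_withKer.mp hf] at h2
    rw [← h2]
    field_simp
  rw [Finset.sum_congr rfl h1, ← Finset.sum_mul]
  ring

end

/-- The kernel `A` paired with the kernel `B` along a permutation. -/
noncomputable def permPairing {X : Type*} [Fintype X] (A B : X → X → ℂ) (π : Equiv.Perm X) : ℂ :=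
  ∑ x, ∑ y, A x y * B (π x) (π y)

theorem permPairing_pow {X : Type*} [Fintype X] (A B : X → X → ℂ)
    (π : Equiv.Perm X) (k : ℕ) :
    permPairing A B π ^ k =
      ∑ f : Fin k ⊕ Fin k → X, edgeProd A f * edgeProd B (π ∘ f) := by
  classical
  have h1 : permPairing A B π = ∑ z : X × X, A z.1 z.2 * B (π z.1) (π z.2) := by
    rw [Fintype.sum_prod_type]
    rfl
  rw [h1, Fintype.sum_pow]
  refine Fintype.sum_equiv ((Equiv.arrowProdEquivProdArrow (Fin k) _ _).trans
    (Equiv.sumArrowEquivProdArrow _ _ _).symm) _ _ fun p => ?_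
  rw [Finset.prod_mul_distrib]
  rfl

section

variable {X : Type*} [Fintype X] [DecidableEq X]

theorem sum_permPairing_pow (A B : X → X → ℂ) (k : ℕ) :
    (∑ π : Equiv.Perm X, permPairing A B π ^ k) / (Fintype.card (Equiv.Perm X) : ℂ) =
      ∑ P : Setoid (Fin k ⊕ Fin k),
        (∑ f ∈ withKer X P, edgeProd A f) * (∑ f ∈ withKer X P, edgeProd B f) /
          ((withKer X P).card : ℂ) := by
  have hne : (Fintype.card (Equiv.Perm X) : ℂ) ≠ 0 := by
    exact_mod_cast Fintype.card_ne_zero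
  rw [div_eq_iff hne, mul_comm, ← sum_mul_sum_perm]
  simp_rw [permPairing_pow, Finset.mul_sum]
  rw [Finset.sum_comm]

end

/-! ### Falling factorials compared with powers -/

theorem pow_sub_descFactorial_mul_le (N k : ℕ) :
    ((N : ℝ) ^ k - (N.descFactorial k : ℕ)) * N ≤ (k : ℝ) ^ 2 * (N : ℝ) ^ k := by
  induction k with
  | zero => simp
  | succ k ih =>
    have h1 : (N : ℝ) - k ≤ ((N - k : ℕ) : ℝ) := by
      rw [sub_le_iff_le_add]
      exact_mod_cast (by omega : N ≤ N - k + k)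
    have h2 : ((N.descFactorial k : ℕ) : ℝ) ≤ (N : ℝ) ^ k := by
      exact_mod_cast Nat.descFactorial_le_pow _ _
    have h3 : (0 : ℝ) ≤ (N.descFactorial k : ℕ) := by positivity
    have hN : (0 : ℝ) ≤ N := by positivity
    rw [Nat.descFactorial_succ]
    push_cast
    have h4 : ((N : ℝ) - k) * (N.descFactorial k : ℕ) ≤
      ((N - k : ℕ) : ℝ) * (N.descFactorial k : ℕ) := mul_le_mul_of_nonneg_right h1 h3
    have h5 := mul_le_mul_of_nonneg_right ih hN
    have h6 := mul_le_mul_of_nonneg_right h4 hN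
    have h7 : (k : ℝ) * N * (N.descFactorial k : ℕ) ≤ k * N * (N : ℝ) ^ k :=
      mul_le_mul_of_nonneg_left h2 (by positivity)
    have h8 : 0 ≤ ((k : ℝ) + 1) * (N : ℝ) * N ^ k := by positivity
    rw [pow_succ]
    nlinarith

theorem pow_le_two_pow_mul_descFactorial {N V : ℕ} (h : 2 * V ≤ N + 2) :
    (N : ℝ) ^ V ≤ 2 ^ V * (N.descFactorial V : ℕ) := by
  have h1 := Nat.pow_sub_le_descFactorial N V
  have h2 : N ^ V ≤ (2 * (N + 1 - V)) ^ V := Nat.pow_le_pow_left (by omega) V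
  rw [mul_pow] at h2
  exact_mod_cast h2.trans (Nat.mul_le_mul_left _ h1)

/-! ### The leading patterns -/

theorem card_eq_of_regular {ι W : Type*} [Fintype ι] [Fintype W] [DecidableEq W]
    (q : ι ⊕ ι → W) (hreg : ∀ w, fiberCard q w = 2) : Fintype.card W = Fintype.card ι := by
  have h := sum_fiberCard q
  simp only [hreg, Finset.sum_const, Finset.card_univ, smul_eq_mul, Fintype.card_sum] at h
  omega

section

variable {ι W X : Type*} [Fintype ι] [Fintype W] [Fintype X] [DecidableEq W] [DecidableEq X]

theorem norm_regular_sub_le {A B : X → X → ℂ} {K : ℝ} (hK0 : 0 ≤ K)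
    (hA : ∀ x y, ‖A x y‖ ≤ K) (hB : ∀ x y, ‖B x y‖ ≤ K) (q : ι ⊕ ι → W)
    (hW : Fintype.card W = Fintype.card ι) (hN : Fintype.card ι ≤ Fintype.card X) :
    ‖injSum A q * injSum B q / ((Fintype.card X).descFactorial (Fintype.card W) : ℕ) -
      fullSum A q * fullSum B q / (Fintype.card X : ℂ) ^ Fintype.card ι‖ * Fintype.card X ≤
      3 * (Fintype.card ι : ℝ) ^ 2 * K ^ (2 * Fintype.card ι) *
        (Fintype.card X : ℝ) ^ Fintype.card ι := by
  have hA1 := norm_injSum_le hA q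
  have hB1 := norm_injSum_le hB q
  have hB2 := norm_fullSum_le hB q
  have hA3 := norm_fullSum_sub_injSum_le hA q
  have hB3 := norm_fullSum_sub_injSum_le hB q
  have hD := pow_sub_descFactorial_mul_le (Fintype.card X) (Fintype.card ι)
  have hDpos : 0 < (Fintype.card X).descFactorial (Fintype.card ι) :=
    Nat.descFactorial_pos.mpr hN
  have hDle : (Fintype.card X).descFactorial (Fintype.card ι) ≤
    Fintype.card X ^ Fintype.card ι := Nat.descFactorial_le_pow _ _
  rw [hW] at *
  set k := Fintype.card ι
  set D : ℕ := (Fintype.card X).descFactorial k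
  set a := injSum A q
  set b := injSum B q
  set a' := fullSum A q
  set b' := fullSum B q
  have hP : ((Fintype.card X : ℂ)) ^ k = (((Fintype.card X ^ k : ℕ) : ℝ) : ℂ) := by push_cast; rfl
  have hDR : (0 : ℝ) < D := by exact_mod_cast hDpos
  have hDleR : (D : ℝ) ≤ (Fintype.card X : ℝ) ^ k := by exact_mod_cast hDle
  set P : ℝ := (Fintype.card X : ℝ) ^ k
  have hPR : 0 < P := hDR.trans_le hDleR
  have hP' : ((Fintype.card X : ℂ)) ^ k = (P : ℂ) := by rw [hP]; push_cast [P]; rfl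
  rw [hP']
  have hDne : (D : ℂ) ≠ 0 := by exact_mod_cast hDpos.ne'
  have hPne : (P : ℂ) ≠ 0 := by exact_mod_cast hPR.ne'
  have hKk : 0 ≤ K ^ k := pow_nonneg hK0 k
  -- Three replacements are made, of `D` by `P`, `b` by `b'` and `a` by `a'`. Each costs at most
  -- `K^(2k) (P - D)`, whence the constant 3.
  have hsplit : a * b / (D : ℂ) - a' * b' / (P : ℂ) =
      a * b * (((P - D : ℝ) : ℂ) / ((D : ℂ) * P)) -
        (a * (b' - b) + (a' - a) * b') / (P : ℂ) := by
    push_cast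
    field_simp
    ring
  have hn1 : ‖a * b * (((P - D : ℝ) : ℂ) / ((D : ℂ) * P))‖ ≤ K ^ k * K ^ k * (P - D) := by
    rw [norm_mul, norm_mul, norm_div, norm_mul, Complex.norm_real, Complex.norm_real,
      Complex.norm_natCast, Real.norm_of_nonneg (sub_nonneg.mpr hDleR),
      Real.norm_of_nonneg hPR.le]
    calc ‖a‖ * ‖b‖ * ((P - D) / (D * P))
        ≤ (K ^ k * D) * (K ^ k * D) * ((P - D) / (D * P)) := by
          have : 0 ≤ (P - D) / (D * P) := div_nonneg (sub_nonneg.mpr hDleR) (by positivity)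
          gcongr
      _ = K ^ k * K ^ k * (P - D) * (D / P) := by
          field_simp
      _ ≤ K ^ k * K ^ k * (P - D) * 1 := by
          refine mul_le_mul_of_nonneg_left ((div_le_one hPR).mpr hDleR) ?_
          have := sub_nonneg.mpr hDleR
          positivity
      _ = _ := mul_one _
  have hn2 : ‖(a * (b' - b) + (a' - a) * b') / (P : ℂ)‖ ≤ 2 * (K ^ k * K ^ k * (P - D)) := by
    rw [norm_div, Complex.norm_real, Real.norm_of_nonneg hPR.le, div_le_iff₀ hPR]
    have hPD := sub_nonneg.mpr hDleR
    calc ‖a * (b' - b) + (a' - a) * b'‖ ≤ ‖a‖ * ‖b' - b‖ + ‖a' - a‖ * ‖b'‖ := by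
          refine (norm_add_le _ _).trans ?_
          rw [norm_mul, norm_mul]
      _ ≤ (K ^ k * P) * (K ^ k * (P - D)) + (K ^ k * (P - D)) * (K ^ k * P) := by
          have : ‖a‖ ≤ K ^ k * P := hA1.trans (mul_le_mul_of_nonneg_left hDleR hKk)
          gcongr
      _ = _ := by ring
  rw [hsplit]
  have htot := (norm_sub_le _ _).trans (add_le_add hn1 hn2)
  refine (mul_le_mul_of_nonneg_right htot (Nat.cast_nonneg _)).trans ?_
  have h9 := mul_le_mul_of_nonneg_left hD (mul_nonneg hKk hKk)
  have hexp : K ^ (2 * k) = K ^ k * K ^ k := by rw [two_mul, pow_add]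
  rw [hexp]
  linarith

end

/-- Each injective sum is of order `N^e`, and the falling factorial in the denominator is comparable
to `N^V`. The choice `2e + 1 ≤ V + card ι` then leaves room for the extra factor `N`. -/
theorem norm_not_regular_le {ι W X : Type} [Fintype ι] [Fintype W] [Fintype X] [DecidableEq W]
    [DecidableEq X] [Nonempty X] {A B : X → X → ℂ} {K : ℝ} (hK0 : 0 ≤ K)
    (hA : ∀ x y, ‖A x y‖ ≤ K) (hB : ∀ x y, ‖B x y‖ ≤ K)
    (hA1 : ∀ x, ∑ y, A x y = 0) (hA2 : ∀ y, ∑ x, A x y = 0)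
    (hB1 : ∀ x, ∑ y, B x y = 0) (hB2 : ∀ y, ∑ x, B x y = 0)
    (q : ι ⊕ ι → W) (hq : Function.Surjective q) (hreg : ¬ ∀ w, fiberCard q w = 2)
    (hN : 4 * Fintype.card ι ≤ Fintype.card X) :
    ‖injSum A q * injSum B q / ((Fintype.card X).descFactorial (Fintype.card W) : ℕ)‖ *
        Fintype.card X ≤
      ((2 * Fintype.card ι).factorial : ℝ) ^ 2 * 4 ^ Fintype.card ι * K ^ (2 * Fintype.card ι) *
        (Fintype.card X : ℝ) ^ Fintype.card ι := by
  obtain ⟨e, he1, he2⟩ := exists_exponent_of_not_regular q hq hreg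
  have ha := norm_injSum_le_of_leaves hA hA1 hA2 _ W q e rfl he1
  have hb := norm_injSum_le_of_leaves hB hB1 hB2 _ W q e rfl he1
  have hWle : Fintype.card W ≤ 2 * Fintype.card ι := by
    have := Fintype.card_le_of_surjective q hq
    rwa [Fintype.card_sum, ← two_mul] at this
  have hD := pow_le_two_pow_mul_descFactorial (N := Fintype.card X) (V := Fintype.card W)
    (by omega)
  have hDpos : 0 < (Fintype.card X).descFactorial (Fintype.card W) :=
    Nat.descFactorial_pos.mpr (by omega)
  have hN1 : (1 : ℝ) ≤ Fintype.card X := by exact_mod_cast Fintype.card_pos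
  have hfac : ((Fintype.card W).factorial : ℝ) ≤ (2 * Fintype.card ι).factorial := by
    exact_mod_cast Nat.factorial_le hWle
  set k := Fintype.card ι
  set V := Fintype.card W
  set N : ℝ := (Fintype.card X : ℝ)
  have hDR : (0 : ℝ) < (Fintype.card X).descFactorial V := by exact_mod_cast hDpos
  set D : ℝ := (((Fintype.card X).descFactorial V : ℕ) : ℝ)
  rw [norm_div, norm_mul, Complex.norm_natCast, div_mul_eq_mul_div, div_le_iff₀ hDR]
  set F : ℝ := (((2 * k).factorial : ℕ) : ℝ)
  have hF : 0 ≤ F := by positivity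
  calc ‖injSum A q‖ * ‖injSum B q‖ * N
      ≤ (F * (K ^ k * N ^ e)) * (F * (K ^ k * N ^ e)) * N := by
        have hx : ((V.factorial : ℕ) : ℝ) * (K ^ k * N ^ e) ≤ F * (K ^ k * N ^ e) :=
          mul_le_mul_of_nonneg_right hfac (by positivity)
        have ha' := ha.trans hx
        have hb' := hb.trans hx
        gcongr
    _ = F ^ 2 * K ^ (2 * k) * N ^ (2 * e + 1) := by ring
    _ ≤ F ^ 2 * K ^ (2 * k) * N ^ (V + k) := by
        gcongr
    _ = F ^ 2 * K ^ (2 * k) * N ^ k * N ^ V := by ring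
    _ ≤ F ^ 2 * K ^ (2 * k) * N ^ k * (2 ^ V * D) := by gcongr
    _ ≤ F ^ 2 * K ^ (2 * k) * N ^ k * (4 ^ k * D) := by
        have : (2 : ℝ) ^ V ≤ 4 ^ k := by
          calc (2 : ℝ) ^ V ≤ 2 ^ (2 * k) := pow_le_pow_right₀ (by norm_num) hWle
            _ = 4 ^ k := by rw [pow_mul]; norm_num
        gcongr
    _ = _ := by ring

open Classical in
/-- The contribution of an equality pattern to the leading term of the moments. -/
noncomputable def regularTerm {ι X : Type*} [Fintype ι] [Fintype X] (A B : X → X → ℂ)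
    (P : Setoid (ι ⊕ ι)) : ℂ :=
  if ∀ w : Quotient P, fiberCard (Quotient.mk P) w = 2 then
    fullSum A (Quotient.mk P) * fullSum B (Quotient.mk P) / (Fintype.card X : ℂ) ^ Fintype.card ι
  else 0

theorem ker_quotient_mk {S : Type*} (P : Setoid S) : Setoid.ker (Quotient.mk P) = P :=
  Setoid.ext fun _ _ => Quotient.eq

theorem norm_moment_sub_regularTerm_le {X : Type} [Fintype X] [DecidableEq X] [Nonempty X]
    {A B : X → X → ℂ} {K : ℝ} (hK0 : 0 ≤ K)
    (hA : ∀ x y, ‖A x y‖ ≤ K) (hB : ∀ x y, ‖B x y‖ ≤ K)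
    (hA1 : ∀ x, ∑ y, A x y = 0) (hA2 : ∀ y, ∑ x, A x y = 0)
    (hB1 : ∀ x, ∑ y, B x y = 0) (hB2 : ∀ y, ∑ x, B x y = 0)
    (k : ℕ) (hN : 4 * k ≤ Fintype.card X) :
    ‖(∑ π : Equiv.Perm X, permPairing A B π ^ k) / (Fintype.card (Equiv.Perm X) : ℂ) -
      ∑ P : Setoid (Fin k ⊕ Fin k), regularTerm A B P‖ * Fintype.card X ≤
      (Fintype.card (Setoid (Fin k ⊕ Fin k)) *
        (3 * (k : ℝ) ^ 2 + ((2 * k).factorial : ℝ) ^ 2 * 4 ^ k)) * K ^ (2 * k) *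
        (Fintype.card X : ℝ) ^ k := by
  classical
  rw [sum_permPairing_pow, ← Finset.sum_sub_distrib]
  refine (mul_le_mul_of_nonneg_right (norm_sum_le _ _) (Nat.cast_nonneg _)).trans ?_
  rw [Finset.sum_mul]
  have hterm : ∀ P : Setoid (Fin k ⊕ Fin k),
      ‖(∑ f ∈ withKer X P, edgeProd A f) * (∑ f ∈ withKer X P, edgeProd B f) /
          ((withKer X P).card : ℂ) - regularTerm A B P‖ * (Fintype.card X : ℝ) ≤
      (3 * (k : ℝ) ^ 2 + ((2 * k).factorial : ℝ) ^ 2 * 4 ^ k) * K ^ (2 * k) *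
        (Fintype.card X : ℝ) ^ k := by
    intro P
    have hsurj : Function.Surjective (Quotient.mk P) := Quotient.mk_surjective
    have hsum : ∀ M : X → X → ℂ, ∑ f ∈ withKer X P, edgeProd M f =
        injSum M (Quotient.mk P) := by
      intro M
      have := sum_withKer_ker (X := X) (edgeProd M) hsurj
      rwa [ker_quotient_mk] at this
    have hcard : (withKer X P).card =
        (Fintype.card X).descFactorial (Fintype.card (Quotient P)) := by
      have := sum_withKer_ker (X := X) (fun _ => (1 : ℕ)) hsurj
      rw [ker_quotient_mk] at this
      simpa [Fintype.card_embedding_eq] using this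
    rw [hsum, hsum, hcard, regularTerm]
    have hc1 : 0 ≤ 3 * (k : ℝ) ^ 2 * K ^ (2 * k) * (Fintype.card X : ℝ) ^ k := by positivity
    have hc2 : 0 ≤ ((2 * k).factorial : ℝ) ^ 2 * 4 ^ k * K ^ (2 * k) *
      (Fintype.card X : ℝ) ^ k := by positivity
    split_ifs with hreg
    · have h := norm_regular_sub_le hK0 hA hB (Quotient.mk P) (card_eq_of_regular _ hreg)
        (by rw [Fintype.card_fin]; omega)
      simp only [Fintype.card_fin] at h ⊢
      refine le_trans ?_ (h.trans ?_)
      · exact le_of_eq (by congr!)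
      · linarith
    · have h := norm_not_regular_le hK0 hA hB hA1 hA2 hB1 hB2 (Quotient.mk P) hsurj hreg
        (by rwa [Fintype.card_fin])
      simp only [Fintype.card_fin] at h
      rw [sub_zero]
      refine h.trans ?_
      linarith
  refine (Finset.sum_le_sum fun P _ => hterm P).trans ?_
  rw [Finset.sum_const, nsmul_eq_mul, Finset.card_univ]
  exact le_of_eq (by ring)

/-! ### Regular patterns and permutations -/

theorem fullSum_equiv {ι W W' X : Type*} [Fintype ι] [Fintype W] [Fintype W'] [Fintype X]
    [DecidableEq W] [DecidableEq W'] (M : X → X → ℂ) (e : W ≃ W')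
    (q : ι ⊕ ι → W) : fullSum M (e ∘ q) = fullSum M q := by
  unfold fullSum
  exact Fintype.sum_equiv (Equiv.arrowCongr e (Equiv.refl X)).symm _ _ fun x => rfl

/-- The multigraph in which the target of the edge `i` is the vertex `i`, and its source is the
vertex `σ i`. -/
def permGraph {ι : Type*} (σ : Equiv.Perm ι) : ι ⊕ ι → ι := Sum.elim σ id

theorem permGraph_surjective {ι : Type*} (σ : Equiv.Perm ι) :
    Function.Surjective (permGraph σ) := fun i => ⟨.inr i, rfl⟩

theorem fiberCard_permGraph {ι : Type*} [Fintype ι] [DecidableEq ι] (σ : Equiv.Perm ι) (i : ι) :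
    fiberCard (permGraph σ) i = 2 := by
  have : (Finset.univ.filter fun s => permGraph σ s = i) = {.inl (σ.symm i), .inr i} := by
    ext s
    rw [Finset.mem_filter]
    rcases s with s | s
    · simp [permGraph, Equiv.eq_symm_apply]
    · simp [permGraph]
  rw [fiberCard, this, Finset.card_pair (by simp)]

/-- The pattern recovers `σ`: the source of `i` is identified with the target of `σ i` and with no
other target. -/
theorem ker_permGraph_injective {ι : Type*} :
    Function.Injective fun σ : Equiv.Perm ι => Setoid.ker (permGraph σ) := by
  intro σ τ h
  ext i
  have h1 : Setoid.ker (permGraph σ) (.inl i) (.inr (σ i)) := rfl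
  have h' : Setoid.ker (permGraph σ) = Setoid.ker (permGraph τ) := h
  rw [h'] at h1
  exact (show τ i = σ i from h1).symm

theorem regularTerm_ker_permGraph {ι X : Type*} [Fintype ι] [DecidableEq ι] [Fintype X]
    (A B : X → X → ℂ) (σ : Equiv.Perm ι) :
    regularTerm A B (Setoid.ker (permGraph σ)) =
      fullSum A (permGraph σ) * fullSum B (permGraph σ) /
        (Fintype.card X : ℂ) ^ Fintype.card ι := by
  classical
  let e := Setoid.quotientKerEquivOfSurjective (permGraph σ) (permGraph_surjective σ)
  have he : e ∘ Quotient.mk (Setoid.ker (permGraph σ)) = permGraph σ := rfl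
  have hM : ∀ M : X → X → ℂ, fullSum M (permGraph σ) =
      fullSum M (Quotient.mk (Setoid.ker (permGraph σ))) := by
    intro M
    rw [← fullSum_equiv M e, he]
  rw [regularTerm, if_pos, hM, hM]
  · congr!
  · intro w
    have := fiberCard_equiv e (Quotient.mk (Setoid.ker (permGraph σ))) w
    rw [he, fiberCard_permGraph] at this
    rw [this]
    congr!

/-- If the columns of `M` are pairwise orthogonal and isotropic, a vertex that is the source of its
two edges makes the sum vanish. -/
theorem fullSum_eq_zero {ι W X : Type*} [Fintype ι] [Fintype W] [Fintype X]
    [DecidableEq W] {M : X → X → ℂ} (hM : ∀ u v, ∑ y, M y u * M y v = 0)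
    (q : ι ⊕ ι → W) {i j : ι} (hij : i ≠ j) (hq : q (.inl i) = q (.inl j))
    (hdeg : fiberCard q (q (.inl i)) = 2) : fullSum M q = 0 := by
  classical
  set w := q (.inl i) with hw
  have hfib : (Finset.univ.filter fun s => q s = w) = {.inl i, .inl j} := by
    symm
    refine Finset.eq_of_subset_of_card_le ?_ ?_
    · intro s hs
      simp only [Finset.mem_insert, Finset.mem_singleton] at hs
      rcases hs with rfl | rfl
      · simp [hw]
      · simp [hq]
    · rw [Finset.card_pair (by simpa using hij)]
      exact hdeg.le
  have hne : ∀ s, s ≠ .inl i → s ≠ .inl j → q s ≠ w := by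
    intro s h1 h2 h3
    have : s ∈ (Finset.univ.filter fun s => q s = w) := by simpa using h3
    rw [hfib] at this
    simp [h1, h2] at this
  unfold fullSum
  rw [← Equiv.sum_comp (Equiv.funSplitAt w X).symm, Fintype.sum_prod_type, Finset.sum_comm]
  refine Finset.sum_eq_zero fun x' _ => ?_
  rcases isEmpty_or_nonempty X with hX | ⟨⟨y₀⟩⟩
  · simp
  set x : X → W → X := fun y => (Equiv.funSplitAt w X).symm (y, x') with hx
  have hxw : ∀ y, x y w = y := fun y => by simp [hx]
  have hxv : ∀ y v, v ≠ w → x y v = x y₀ v := fun y v hv => by simp [hx, hv]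
  have hterm : ∀ y, edgeProd M (x y ∘ q) =
      M y (x y₀ (q (.inr i))) * M y (x y₀ (q (.inr j))) *
        ∏ l ∈ (Finset.univ.erase i).erase j, M (x y₀ (q (.inl l))) (x y₀ (q (.inr l))) := by
    intro y
    unfold edgeProd
    rw [← Finset.mul_prod_erase _ _ (Finset.mem_univ i),
      ← Finset.mul_prod_erase _ _ (Finset.mem_erase.mpr ⟨hij.symm, Finset.mem_univ j⟩),
      ← mul_assoc]
    simp only [Function.comp_apply]
    rw [← hw, ← hq, hxw, hxv y _ (hne (.inr i) (by simp) (by simp)),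
      hxv y _ (hne (.inr j) (by simp) (by simp))]
    congr 1
    refine Finset.prod_congr rfl fun l hl => ?_
    rw [Finset.mem_erase, Finset.mem_erase] at hl
    rw [hxv y _ (hne (.inl l) (by simpa using hl.2.1) (by simpa using hl.1)),
      hxv y _ (hne (.inr l) (by simp) (by simp))]
  change ∑ y, edgeProd M (x y ∘ q) = 0
  simp_rw [hterm, ← Finset.sum_mul, hM, zero_mul]

theorem exists_perm_of_regular {ι W : Type*} [Fintype ι] [Fintype W] [DecidableEq W]
    (q : ι ⊕ ι → W) (hreg : ∀ w, fiberCard q w = 2)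
    (hinj : Function.Injective fun i => q (.inl i)) :
    ∃ σ : Equiv.Perm ι, Setoid.ker (permGraph σ) = Setoid.ker q := by
  classical
  have hcard := card_eq_of_regular q hreg
  -- There are as many vertices as edges, so each vertex is a source exactly once. Degree two then
  -- makes it a target exactly once, and matching sources with targets defines `σ`.
  have hbij := (Fintype.bijective_iff_injective_and_card _).mpr ⟨hinj, hcard.symm⟩
  have hsurj : Function.Surjective fun i => q (.inr i) := by
    intro w
    by_contra! hno
    obtain ⟨i, hi⟩ := hbij.2 w
    have h1 : (Finset.univ.filter fun s => q s = w) ⊆ {.inl i} := by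
      intro s hs
      simp only [Finset.mem_filter, Finset.mem_univ, true_and] at hs
      rcases s with s | s
      · simp only [Finset.mem_singleton, Sum.inl.injEq]
        exact hinj (hs.trans hi.symm)
      · exact absurd hs (hno s)
    have h2 := Finset.card_le_card h1
    have h3 := hreg w
    rw [fiberCard] at h3
    rw [h3, Finset.card_singleton] at h2
    omega
  have hbij' := (Fintype.bijective_iff_surjective_and_card _).mpr ⟨hsurj, hcard.symm⟩
  let s := Equiv.ofBijective _ hbij
  let t := Equiv.ofBijective _ hbij'
  refine ⟨s.trans t.symm, ?_⟩
  have hq : q = t ∘ permGraph (s.trans t.symm) := by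
    funext z
    rcases z with z | z
    · simp [permGraph, s]
    · simp [permGraph, t]
  conv_rhs => rw [hq]
  exact (ker_comp_of_injective _ t.injective).symm

/-- A regular pattern that does not come from a permutation has a vertex that is the source of two
edges, so its `A`-sum vanishes by `fullSum_eq_zero`. Nothing is needed of `B`. -/
theorem sum_regularTerm {ι X : Type*} [Fintype ι] [DecidableEq ι] [Fintype X]
    {A : X → X → ℂ} (B : X → X → ℂ) (hA : ∀ u v, ∑ y, A y u * A y v = 0) :
    ∑ P : Setoid (ι ⊕ ι), regularTerm A B P = ∑ σ : Equiv.Perm ι,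
      fullSum A (permGraph σ) * fullSum B (permGraph σ) /
        (Fintype.card X : ℂ) ^ Fintype.card ι := by
  classical
  symm
  refine Fintype.sum_of_injective _ ker_permGraph_injective _ _ (fun P hP => ?_)
    (fun σ => (regularTerm_ker_permGraph A B σ).symm)
  rw [regularTerm]
  split_ifs with hreg
  · have hni : ¬ Function.Injective fun i => Quotient.mk P (.inl i) := by
      intro hinj
      obtain ⟨σ, hσ⟩ := exists_perm_of_regular _ hreg hinj
      exact hP ⟨σ, hσ.trans (ker_quotient_mk P)⟩
    rw [Function.not_injective_iff] at hni
    obtain ⟨i, j, hq, hij⟩ := hni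
    rw [fullSum_eq_zero hA _ hij hq (hreg _), zero_mul, zero_div]
  · rfl

/-! ### Cycle products -/

section

variable {ι : Type*} [Fintype ι] [DecidableEq ι]

-- Rewrites the product over cycle lengths as one over orbits, the index set on which invariant
-- colourings live. Orbits inside the support match the cycle factors of `σ`; the others are fixed
-- points, the parts equal to 1.
open Classical in
theorem prod_fiberCard_sameCycle {R : Type*} [CommMonoid R] (σ : Equiv.Perm ι) (h : ℕ → R) :
    ∏ c : Quotient (Equiv.Perm.SameCycle.setoid σ), h (fiberCard (Quotient.mk _) c) =
      (σ.partition.parts.map h).prod := by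
  have hfib : ∀ c : Quotient (Equiv.Perm.SameCycle.setoid σ),
      (Finset.univ.filter fun x => Quotient.mk (Equiv.Perm.SameCycle.setoid σ) x = c) =
        Finset.univ.filter fun x => σ.SameCycle c.out x := by
    intro c
    ext x
    simp only [Finset.mem_filter, Finset.mem_univ, true_and]
    rw [eq_comm]
    conv_lhs => rw [← Quotient.out_eq c]
    exact Quotient.eq
  rw [Equiv.Perm.parts_partition, Multiset.map_add, Multiset.prod_add, Multiset.map_replicate,
    Multiset.prod_replicate, Equiv.Perm.cycleType_def, Multiset.map_map,
    ← Finset.prod_filter_mul_prod_filter_not Finset.univ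
      fun c : Quotient (Equiv.Perm.SameCycle.setoid σ) => c.out ∈ σ.support]
  congr 1
  · change _ = ∏ g ∈ σ.cycleFactorsFinset, h (g.support.card)
    refine Finset.prod_bij (fun c _ => σ.cycleOf c.out) (fun c hc => ?_) (fun c hc d hd hcd => ?_)
      (fun g hg => ?_) (fun c hc => ?_)
    · rw [Equiv.Perm.cycleOf_mem_cycleFactorsFinset_iff]
      exact (Finset.mem_filter.mp hc).2
    · have := (Equiv.Perm.sameCycle_iff_cycleOf_eq_of_mem_support
        (Finset.mem_filter.mp hc).2 (Finset.mem_filter.mp hd).2).mpr hcd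
      rw [← Quotient.out_eq c, ← Quotient.out_eq d]
      exact Quotient.sound this
    · obtain ⟨x, hx⟩ := (Equiv.Perm.mem_cycleFactorsFinset_iff.mp hg).1.nonempty_support
      have hgx := Equiv.Perm.cycle_is_cycleOf hx hg
      have hxs : x ∈ σ.support :=
        Equiv.Perm.mem_cycleFactorsFinset_support_le hg hx
      set c := Quotient.mk (Equiv.Perm.SameCycle.setoid σ) x with hc
      have hcx : σ.SameCycle c.out x := Quotient.exact (Quotient.out_eq c)
      have hcs : c.out ∈ σ.support := by
        rw [Equiv.Perm.mem_support] at hxs ⊢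
        rwa [Ne, hcx.apply_eq_self_iff]
      refine ⟨c, by simpa using hcs, ?_⟩
      rw [hgx]
      exact (Equiv.Perm.sameCycle_iff_cycleOf_eq_of_mem_support hcs hxs).mp hcx
    · rw [fiberCard, hfib]
      congr 2
      ext x
      rw [Equiv.Perm.mem_support_cycleOf_iff]
      simp [(Finset.mem_filter.mp hc).2]
  · have h1 : ∀ c ∈ Finset.univ.filter
        (fun c : Quotient (Equiv.Perm.SameCycle.setoid σ) => ¬ c.out ∈ σ.support),
        h (fiberCard (Quotient.mk _) c) = h 1 := by
      intro c hc
      have hc' := (Finset.mem_filter.mp hc).2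
      rw [Equiv.Perm.notMem_support] at hc'
      rw [fiberCard, hfib, Finset.card_eq_one.mpr ⟨c.out, ?_⟩]
      ext x
      simp only [Finset.mem_filter, Finset.mem_univ, true_and, Finset.mem_singleton]
      refine ⟨fun hx => ?_, fun hx => hx ▸ Equiv.Perm.SameCycle.refl _ _⟩
      exact (Equiv.Perm.SameCycle.eq_of_left hx hc').symm
    rw [Finset.prod_congr rfl h1, Finset.prod_const]
    congr 1
    rw [← Finset.card_compl]
    refine Finset.card_bij (fun c _ => c.out) (fun c hc => by simpa using hc)
      (fun c _ d _ hcd => ?_) (fun x hx => ?_)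
    · rw [← Quotient.out_eq c, ← Quotient.out_eq d, hcd]
    · set c := Quotient.mk (Equiv.Perm.SameCycle.setoid σ) x with hc
      have hcx : σ.SameCycle c.out x := Quotient.exact (Quotient.out_eq c)
      rw [Finset.mem_compl, Equiv.Perm.notMem_support] at hx
      have : c.out = x := hcx.eq_of_right hx
      exact ⟨c, by simp [this, hx], this⟩

/-- The sum of a product weight over the colourings invariant under a permutation factors over the
cycles. -/
theorem sum_invariant_prod {G : Type*} [Fintype G] [DecidableEq G] (σ : Equiv.Perm ι)
    (a : G → ℂ) :
    ∑ p : ι → G with ∀ i, p (σ i) = p i, ∏ i, a (p i) =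
      (σ.partition.parts.map fun l => ∑ g, a g ^ l).prod := by
  classical
  rw [← prod_fiberCard_sameCycle, Fintype.prod_sum]
  symm
  refine Finset.sum_bij (fun y _ => y ∘ Quotient.mk _) (fun y _ => ?_) (fun y _ z _ h => ?_)
    (fun p hp => ?_) (fun y _ => ?_)
  · simp only [Finset.mem_filter, Finset.mem_univ, true_and, Function.comp_apply]
    intro i
    congr 1
    exact Quotient.sound ((Equiv.Perm.sameCycle_apply_left).mpr (Equiv.Perm.SameCycle.refl _ _))
  · exact Quotient.mk_surjective.injective_comp_right h
  · have hp' : ∀ i, p (σ i) = p i := by simpa using hp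
    have hsame : ∀ i j, σ.SameCycle i j → p i = p j := by
      intro i j hij
      obtain ⟨m, hm⟩ := hij.exists_nat_pow_eq
      rw [← hm]
      clear hm
      induction m with
      | zero => rfl
      | succ m ih => rw [pow_succ', Equiv.Perm.mul_apply, hp', ih]
    exact ⟨fun c => Quotient.lift p hsame c, Finset.mem_univ _, rfl⟩
  · rw [← Finset.prod_fiberwise (s := Finset.univ)
      (g := fun i => Quotient.mk (Equiv.Perm.SameCycle.setoid σ) i)]
    refine Finset.prod_congr rfl fun c _ => ?_
    rw [Finset.prod_congr rfl (g := fun _ => a (y c)), Finset.prod_const]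
    · rfl
    · intro i hi
      rw [Function.comp_apply, (Finset.mem_filter.mp hi).2]

end

/-! ### Circulant kernels -/

theorem AddChar.map_sum_eq_prod {ι A M : Type*} [AddCommMonoid A] [CommMonoid M] (ψ : AddChar A M)
    (s : Finset ι) (f : ι → A) : ψ (∑ i ∈ s, f i) = ∏ i ∈ s, ψ (f i) := by
  classical
  induction s using Finset.induction_on with
  | empty => simp
  | insert i s hi ih => rw [Finset.sum_insert hi, Finset.prod_insert hi, ψ.map_add_eq_mul, ih]

section

variable {N : ℕ} [NeZero N]

/-- The translation-invariant kernel with the given Fourier coefficients. -/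
noncomputable def circ (a : ZMod N → ℂ) (x y : ZMod N) : ℂ :=
  ∑ p, a p * ZMod.stdAddChar (p * (y - x))

theorem norm_stdAddChar (x : ZMod N) : ‖(ZMod.stdAddChar x : ℂ)‖ = 1 := by
  rw [ZMod.stdAddChar_apply]
  exact Circle.norm_coe _

theorem norm_circ_le (a : ZMod N → ℂ) (x y : ZMod N) : ‖circ a x y‖ ≤ ∑ p, ‖a p‖ := by
  refine (norm_sum_le _ _).trans (Finset.sum_le_sum fun p _ => ?_)
  rw [norm_mul, norm_stdAddChar, mul_one]

theorem sum_stdAddChar_mul (b : ZMod N) :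
    ∑ x : ZMod N, (ZMod.stdAddChar (x * b) : ℂ) = if b = 0 then (N : ℂ) else 0 := by
  rw [AddChar.sum_mulShift b (ZMod.isPrimitive_stdAddChar N), ZMod.card]
  split_ifs <;> simp

theorem sum_circ_right {a : ZMod N → ℂ} (h0 : a 0 = 0) (x : ZMod N) : ∑ y, circ a x y = 0 := by
  unfold circ
  rw [Finset.sum_comm]
  refine Finset.sum_eq_zero fun p _ => ?_
  rw [← Finset.mul_sum, ← Equiv.sum_comp (Equiv.addRight x)]
  simp only [Equiv.coe_addRight, add_sub_cancel_right]
  simp_rw [mul_comm p]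
  rw [sum_stdAddChar_mul]
  split_ifs with hp
  · rw [hp, h0, zero_mul]
  · rw [mul_zero]

theorem sum_circ_left {a : ZMod N → ℂ} (h0 : a 0 = 0) (y : ZMod N) : ∑ x, circ a x y = 0 := by
  unfold circ
  rw [Finset.sum_comm]
  refine Finset.sum_eq_zero fun p _ => ?_
  rw [← Finset.mul_sum, ← Equiv.sum_comp (Equiv.subLeft y)]
  simp only [Equiv.subLeft_apply, sub_sub_cancel]
  simp_rw [mul_comm p]
  rw [sum_stdAddChar_mul]
  split_ifs with hp
  · rw [hp, h0, zero_mul]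
  · rw [mul_zero]

/-- Summing over `y` keeps only opposite frequencies `p` and `-p`, and a one-sided spectrum never
contains both. -/
theorem sum_circ_mul_circ {a : ZMod N → ℂ} (ha : ∀ p, a p * a (-p) = 0) (u v : ZMod N) :
    ∑ y, circ a y u * circ a y v = 0 := by
  unfold circ
  simp_rw [Finset.sum_mul_sum]
  rw [Finset.sum_comm]
  refine Finset.sum_eq_zero fun p _ => ?_
  rw [Finset.sum_comm]
  refine Finset.sum_eq_zero fun r _ => ?_
  have h1 : ∀ y, a p * ZMod.stdAddChar (p * (u - y)) * (a r * ZMod.stdAddChar (r * (v - y))) =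
      a p * a r * ZMod.stdAddChar (p * u + r * v) * ZMod.stdAddChar (y * (-p - r)) := by
    intro y
    have : (ZMod.stdAddChar (p * (u - y)) : ℂ) * ZMod.stdAddChar (r * (v - y)) =
        ZMod.stdAddChar (p * u + r * v) * ZMod.stdAddChar (y * (-p - r)) := by
      rw [← AddChar.map_add_eq_mul, ← AddChar.map_add_eq_mul]
      congr 1
      ring
    linear_combination a p * a r * this
  simp_rw [h1, ← Finset.mul_sum, sum_stdAddChar_mul]
  split_ifs with h
  · have : r = -p := (sub_eq_zero.mp h).symm
    rw [this, ha, zero_mul, zero_mul]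
  · rw [mul_zero]

/-- Give each edge a frequency `p i`. Summing over the label of vertex `i` forces the frequencies of
its incoming and outgoing edges to agree, so `p` is constant on cycles and each vertex yields a
factor `N`. -/
theorem fullSum_circ {ι : Type*} [Fintype ι] [DecidableEq ι] (a : ZMod N → ℂ)
    (σ : Equiv.Perm ι) :
    fullSum (circ a) (permGraph σ) =
      (N : ℂ) ^ Fintype.card ι * (σ.partition.parts.map fun l => ∑ p, a p ^ l).prod := by
  rw [← sum_invariant_prod]
  have h1 : ∀ x : ι → ZMod N, edgeProd (circ a) (x ∘ permGraph σ) =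
      ∑ p : ι → ZMod N, (∏ i, a (p i)) *
        ∏ i, (ZMod.stdAddChar (x i * (p i - p (σ.symm i))) : ℂ) := by
    intro x
    unfold edgeProd circ
    rw [Fintype.prod_sum]
    refine Finset.sum_congr rfl fun p _ => ?_
    rw [Finset.prod_mul_distrib]
    congr 1
    simp only [Function.comp_apply, permGraph, Sum.elim_inl, Sum.elim_inr, id]
    rw [← AddChar.map_sum_eq_prod, ← AddChar.map_sum_eq_prod]
    congr 1
    simp_rw [mul_sub, Finset.sum_sub_distrib]
    congr 1
    · exact Finset.sum_congr rfl fun i _ => mul_comm _ _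
    -- Vertex `σ i` is the source of edge `i`; reindexing by `σ` collects the exponent by vertices.
    · rw [← Equiv.sum_comp σ (fun i => x i * p (σ.symm i))]
      exact Finset.sum_congr rfl fun i _ => by rw [Equiv.symm_apply_apply, mul_comm]
  unfold fullSum
  simp_rw [h1]
  rw [Finset.sum_comm]
  simp_rw [← Finset.mul_sum]
  have h2 : ∀ p : ι → ZMod N,
      ∑ x : ι → ZMod N, ∏ i, (ZMod.stdAddChar (x i * (p i - p (σ.symm i))) : ℂ) =
        if ∀ i, p (σ i) = p i then (N : ℂ) ^ Fintype.card ι else 0 := by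
    intro p
    rw [← Fintype.prod_sum fun i (y : ZMod N) =>
      (ZMod.stdAddChar (y * (p i - p (σ.symm i))) : ℂ)]
    simp_rw [sum_stdAddChar_mul]
    split_ifs with hp
    · rw [Finset.prod_congr rfl (g := fun _ => (N : ℂ))]
      · simp
      · intro i _
        rw [if_pos]
        rw [sub_eq_zero]
        conv_lhs => rw [← σ.apply_symm_apply i]
        exact hp _
    · push Not at hp
      obtain ⟨i, hi⟩ := hp
      refine Finset.prod_eq_zero (Finset.mem_univ (σ i)) ?_
      rw [if_neg]
      rw [Equiv.symm_apply_apply, sub_eq_zero]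
      exact hi
  simp_rw [h2]
  rw [Finset.sum_filter, Finset.mul_sum]
  refine Finset.sum_congr rfl fun p _ => ?_
  split_ifs <;> ring

end

/-- Both kernels are bounded by the `ℓ¹` norms of their spectra. These grow only logarithmically in
the application, so the error `K^(2k)/N` still tends to zero. -/
theorem norm_moment_circ_sub_le {N : ℕ} [NeZero N] {a b : ZMod N → ℂ} {K : ℝ}
    (ha0 : a 0 = 0) (hb0 : b 0 = 0) (ha : ∀ p, a p * a (-p) = 0)
    (haK : ∑ p, ‖a p‖ ≤ K) (hbK : ∑ p, ‖b p‖ ≤ K) (k : ℕ) (hN : 4 * k ≤ N) :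
    ‖(∑ π : Equiv.Perm (ZMod N), (permPairing (circ a) (circ b) π / N) ^ k) /
        (Fintype.card (Equiv.Perm (ZMod N)) : ℂ) -
      ∑ σ : Equiv.Perm (Fin k),
        (σ.partition.parts.map fun l => (∑ p, a p ^ l) * ∑ p, b p ^ l).prod‖ ≤
      (Fintype.card (Setoid (Fin k ⊕ Fin k)) *
        (3 * (k : ℝ) ^ 2 + ((2 * k).factorial : ℝ) ^ 2 * 4 ^ k)) * (K ^ (2 * k) / N) := by
  have hK0 : 0 ≤ K := (Finset.sum_nonneg fun _ _ => norm_nonneg _).trans haK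
  have hmain := norm_moment_sub_regularTerm_le hK0
    (fun x y => (norm_circ_le a x y).trans haK) (fun x y => (norm_circ_le b x y).trans hbK)
    (sum_circ_right ha0) (sum_circ_left ha0) (sum_circ_right hb0) (sum_circ_left hb0) k
    (by rwa [ZMod.card])
  rw [sum_regularTerm _ (sum_circ_mul_circ ha)] at hmain
  simp only [fullSum_circ, ZMod.card, Fintype.card_fin] at hmain
  have hNR : (0 : ℝ) < N := by exact_mod_cast NeZero.pos N
  have hNC : (N : ℂ) ≠ 0 := by exact_mod_cast (NeZero.ne N)
  have hNk : (0 : ℝ) < (N : ℝ) ^ k := by positivity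
  have hσ : ∀ σ : Equiv.Perm (Fin k),
      (N : ℂ) ^ k * (σ.partition.parts.map fun l => ∑ p, a p ^ l).prod *
        ((N : ℂ) ^ k * (σ.partition.parts.map fun l => ∑ p, b p ^ l).prod) / (N : ℂ) ^ k =
      (N : ℂ) ^ k *
        (σ.partition.parts.map fun l => (∑ p, a p ^ l) * ∑ p, b p ^ l).prod := by
    intro σ
    rw [Multiset.prod_map_mul]
    field_simp
  simp_rw [hσ] at hmain
  rw [← Finset.mul_sum] at hmain
  have hfac : (∑ π : Equiv.Perm (ZMod N), permPairing (circ a) (circ b) π ^ k) /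
        (Fintype.card (Equiv.Perm (ZMod N)) : ℂ) =
      (N : ℂ) ^ k * ((∑ π : Equiv.Perm (ZMod N), (permPairing (circ a) (circ b) π / N) ^ k) /
        (Fintype.card (Equiv.Perm (ZMod N)) : ℂ)) := by
    simp_rw [div_pow]
    rw [← Finset.sum_div]
    field_simp
  rw [hfac, ← mul_sub, norm_mul, norm_pow, Complex.norm_natCast] at hmain
  rw [← mul_div_assoc, le_div_iff₀ hNR]
  refine le_of_mul_le_mul_left ?_ hNk
  linarith

/-! ### Fourier coefficients of the square wave and of the sawtooth -/

section

variable {N : ℕ} [NeZero N]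

/-- The Fourier coefficients of a function on `ℤ/N`. -/
noncomputable def fourierCoef (f : ZMod N → ℂ) (p : ZMod N) : ℂ :=
  (N : ℂ)⁻¹ * ∑ d, ZMod.stdAddChar (-(d * p)) * f d

theorem circ_fourierCoef (f : ZMod N → ℂ) (x y : ZMod N) :
    circ (fourierCoef f) x y = f (y - x) := by
  have h : ZMod.dft.symm (ZMod.dft f) (y - x) = f (y - x) := by simp
  rw [← h, ZMod.invDFT_apply, circ, smul_eq_mul, Finset.mul_sum]
  refine Finset.sum_congr rfl fun p _ => ?_
  rw [ZMod.dft_apply, fourierCoef]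
  simp only [smul_eq_mul]
  ring

theorem fourierCoef_neg {f : ZMod N → ℂ} (hf : ∀ d, f (-d) = - f d) (p : ZMod N) :
    fourierCoef f (-p) = - fourierCoef f p := by
  unfold fourierCoef
  rw [← mul_neg, ← Finset.sum_neg_distrib, ← Equiv.sum_comp (Equiv.neg (ZMod N))]
  congr 1
  refine Finset.sum_congr rfl fun d _ => ?_
  simp [hf]

theorem fourierCoef_zero {f : ZMod N → ℂ} (hf : ∀ d, f (-d) = - f d) : fourierCoef f 0 = 0 := by
  have h := fourierCoef_neg hf 0
  rw [neg_zero] at h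
  exact self_eq_neg.mp h

theorem sum_zmod_eq_sum_range {R : Type*} [AddCommMonoid R] (g : ZMod N → R) :
    ∑ x, g x = ∑ d ∈ Finset.range N, g (d : ZMod N) := by
  symm
  refine Finset.sum_bij (fun d _ => (d : ZMod N)) (fun _ _ => Finset.mem_univ _)
    (fun d hd e he h => ?_) (fun x _ => ⟨x.val, ?_, ?_⟩) (fun _ _ => rfl)
  · have := congrArg ZMod.val h
    rwa [ZMod.val_natCast_of_lt (Finset.mem_range.mp hd),
      ZMod.val_natCast_of_lt (Finset.mem_range.mp he)] at this
  · exact Finset.mem_range.mpr (ZMod.val_lt x)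
  · exact ZMod.natCast_zmod_val x

end

theorem zmod_neg_natCast_eq {n d : ℕ} (hd : d ≤ 2 * n + 1) :
    -(d : ZMod (2 * n + 1)) = ((2 * n + 1 - d : ℕ) : ZMod (2 * n + 1)) := by
  rw [Nat.cast_sub hd, ZMod.natCast_self, zero_sub]

theorem sum_zmod_eq_sum_Icc {R : Type*} [AddCommMonoid R] (n : ℕ) (g : ZMod (2 * n + 1) → R) :
    ∑ x, g x = g 0 + ∑ d ∈ Finset.Icc 1 n, (g d + g (-(d : ZMod (2 * n + 1)))) := by
  rw [sum_zmod_eq_sum_range, Finset.sum_add_distrib, Finset.sum_range_succ']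
  simp only [Nat.cast_zero]
  rw [add_comm]
  congr 1
  have h1 : ∑ d ∈ Finset.Icc 1 n, g (-(d : ZMod (2 * n + 1))) =
      ∑ d ∈ Finset.Icc (n + 1) (2 * n), g (d : ZMod (2 * n + 1)) := by
    refine Finset.sum_bij (fun d _ => 2 * n + 1 - d) (fun d hd => ?_) (fun d hd e he h => ?_)
      (fun d hd => ⟨2 * n + 1 - d, ?_, ?_⟩) (fun d hd => ?_)
    · rw [Finset.mem_Icc] at hd ⊢; omega
    · rw [Finset.mem_Icc] at hd he; omega
    · rw [Finset.mem_Icc] at hd ⊢; omega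
    · rw [Finset.mem_Icc] at hd; omega
    · rw [Finset.mem_Icc] at hd
      rw [zmod_neg_natCast_eq (by omega)]
  rw [h1, Finset.range_eq_Ico, Finset.sum_Ico_add' (fun d : ℕ => g (d : ZMod (2 * n + 1))),
    ← Finset.sum_union]
  · refine Finset.sum_congr ?_ fun _ _ => rfl
    ext d
    simp only [Finset.mem_Ico, Finset.mem_union, Finset.mem_Icc]
    omega
  · rw [Finset.disjoint_left]
    intro d hd
    rw [Finset.mem_Icc] at hd ⊢
    omega

/-! ### The writhe as a pairing of two circulant kernels -/

/-- The indicator function of `{1, …, n}`. -/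
noncomputable def halfIndicator (n : ℕ) (d : ZMod (2 * n + 1)) : ℂ :=
  if d ≠ 0 ∧ d.val ≤ n then 1 else 0

/-- The function equal to `1` on `{1, …, n}` and to `-1` on `{-1, …, -n}`. -/
noncomputable def squareWave (n : ℕ) (d : ZMod (2 * n + 1)) : ℂ :=
  halfIndicator n d - halfIndicator n (-d)

/-- The function `d ↦ 1 - 2 d / (2 n + 1)` on `{1, …, 2n}`, and zero at zero. -/
noncomputable def sawtooth (n : ℕ) (d : ZMod (2 * n + 1)) : ℂ :=
  if d = 0 then 0 else 1 - 2 * (d.val : ℂ) / ((2 * n + 1 : ℕ) : ℂ)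

theorem squareWave_neg (n : ℕ) (d : ZMod (2 * n + 1)) : squareWave n (-d) = - squareWave n d := by
  simp [squareWave]

theorem zmod_val_neg_of_ne_zero {n : ℕ} {d : ZMod (2 * n + 1)} (hd : d ≠ 0) :
    (-d).val = 2 * n + 1 - d.val := by
  rw [ZMod.neg_val, if_neg hd]

theorem sawtooth_neg (n : ℕ) (d : ZMod (2 * n + 1)) : sawtooth n (-d) = - sawtooth n d := by
  unfold sawtooth
  by_cases hd : d = 0
  · simp [hd]
  · rw [if_neg hd, if_neg (neg_ne_zero.mpr hd), zmod_val_neg_of_ne_zero hd,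
      Nat.cast_sub (ZMod.val_lt d).le]
    have : ((2 * n + 1 : ℕ) : ℂ) ≠ 0 := Nat.cast_ne_zero.mpr (Nat.succ_ne_zero _)
    field_simp
    ring

theorem halfIndicator_mul_neg (n : ℕ) (d : ZMod (2 * n + 1)) :
    halfIndicator n d * halfIndicator n (-d) = 0 := by
  unfold halfIndicator
  by_cases hd : d = 0
  · simp [hd]
  · rw [zmod_val_neg_of_ne_zero hd]
    have := ZMod.val_lt d
    split_ifs with h1 h2 <;> simp
    omega

theorem halfIndicator_add_neg {n : ℕ} {d : ZMod (2 * n + 1)} (hd : d ≠ 0) :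
    halfIndicator n d + halfIndicator n (-d) = 1 := by
  unfold halfIndicator
  rw [zmod_val_neg_of_ne_zero hd]
  have h0 := ZMod.val_lt d
  have hd' : -d ≠ 0 := neg_ne_zero.mpr hd
  by_cases h : d.val ≤ n
  · rw [if_pos ⟨hd, h⟩, if_neg (by omega), add_zero]
  · rw [if_neg (by tauto), if_pos ⟨hd', by omega⟩, zero_add]

theorem zmod_natCast_ne_zero {n d : ℕ} (h1 : 1 ≤ d) (h2 : d ≤ n) : (d : ZMod (2 * n + 1)) ≠ 0 := by
  rw [Ne, ZMod.natCast_eq_zero_iff]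
  exact Nat.not_dvd_of_pos_of_lt (by omega) (by omega)

theorem halfIndicator_natCast {n d : ℕ} (h1 : 1 ≤ d) (h2 : d ≤ n) :
    halfIndicator n (d : ZMod (2 * n + 1)) = 1 := by
  rw [halfIndicator, if_pos]
  refine ⟨zmod_natCast_ne_zero h1 h2, ?_⟩
  rwa [ZMod.val_natCast_of_lt (by omega)]

theorem halfIndicator_neg_natCast {n d : ℕ} (h1 : 1 ≤ d) (h2 : d ≤ n) :
    halfIndicator n (-(d : ZMod (2 * n + 1))) = 0 := by
  have h := halfIndicator_mul_neg n (d : ZMod (2 * n + 1))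
  rwa [halfIndicator_natCast h1 h2, one_mul] at h

theorem sum_halfIndicator_mul (n : ℕ) (g : ZMod (2 * n + 1) → ℂ) :
    ∑ d, halfIndicator n d * g d = ∑ d ∈ Finset.Icc 1 n, g (d : ZMod (2 * n + 1)) := by
  rw [sum_zmod_eq_sum_Icc]
  have h0 : halfIndicator n 0 = 0 := by simp [halfIndicator]
  rw [h0, zero_mul, zero_add]
  refine Finset.sum_congr rfl fun d hd => ?_
  rw [Finset.mem_Icc] at hd
  rw [halfIndicator_natCast hd.1 hd.2, halfIndicator_neg_natCast hd.1 hd.2]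
  ring

/-- The positive-frequency half of the Fourier coefficients of the square wave. -/
noncomputable def halfCoef (n : ℕ) (p : ZMod (2 * n + 1)) : ℂ :=
  halfIndicator n p * fourierCoef (squareWave n) p

/-- Swapping the arguments negates the frequency, and the coefficients of the odd square wave are
odd; so the subtracted term supplies exactly the missing negative frequencies. -/
theorem circ_halfCoef_sub (n : ℕ) (x y : ZMod (2 * n + 1)) :
    circ (halfCoef n) x y - circ (halfCoef n) y x = squareWave n (y - x) := by
  rw [← circ_fourierCoef (squareWave n) x y]
  have h1 : circ (halfCoef n) y x =
      ∑ p, halfCoef n (-p) * ZMod.stdAddChar (p * (y - x)) := by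
    unfold circ
    rw [← Equiv.sum_comp (Equiv.neg _)]
    refine Finset.sum_congr rfl fun p _ => ?_
    simp only [Equiv.neg_apply]
    congr 2
    ring
  rw [h1, circ, circ, ← Finset.sum_sub_distrib]
  refine Finset.sum_congr rfl fun p _ => ?_
  rw [← sub_mul]
  congr 1
  unfold halfCoef
  rw [fourierCoef_neg (squareWave_neg n)]
  by_cases hp : p = 0
  · simp [hp, fourierCoef_zero (squareWave_neg n)]
  · linear_combination fourierCoef (squareWave n) p * halfIndicator_add_neg hp

/-- This is what makes the sign kernel translation invariant: wrapping around the circle changes the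
sign by 2, and `2(v - u)/N` jumps by the same amount. -/
theorem sawtooth_sub (n : ℕ) (u v : ZMod (2 * n + 1)) :
    sawtooth n (v - u) =
      ((SignType.sign ((v.val : ℝ) - (u.val : ℝ)) : ℤ) : ℂ) -
        2 / ((2 * n + 1 : ℕ) : ℂ) * ((v.val : ℂ) - u.val) := by
  have hN : ((2 * n + 1 : ℕ) : ℂ) ≠ 0 := Nat.cast_ne_zero.mpr (Nat.succ_ne_zero _)
  unfold sawtooth
  rcases lt_trichotomy u.val v.val with h | h | h
  · have hne : v - u ≠ 0 := by
      rw [sub_ne_zero]; rintro rfl; exact lt_irrefl _ h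
    have hs : (0 : ℝ) < (v.val : ℝ) - u.val := by
      rw [sub_pos]; exact_mod_cast h
    rw [if_neg hne, ZMod.val_sub h.le, Nat.cast_sub h.le, sign_pos hs]
    simp only [SignType.coe_one, Int.cast_one]
    ring
  · have : u = v := ZMod.val_injective _ h
    subst this
    simp
  · have hne : u - v ≠ 0 := by
      rw [sub_ne_zero]; rintro rfl; exact lt_irrefl _ h
    have hne' : v - u ≠ 0 := by rw [← neg_sub]; exact neg_ne_zero.mpr hne
    have hs : (v.val : ℝ) - u.val < 0 := by
      rw [sub_neg]; exact_mod_cast h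
    rw [if_neg hne', ← neg_sub u v, zmod_val_neg_of_ne_zero hne,
      Nat.cast_sub (ZMod.val_lt _).le, ZMod.val_sub h.le, Nat.cast_sub h.le, sign_neg hs]
    simp only [SignType.coe_neg_one, Int.cast_neg, Int.cast_one]
    field_simp
    ring

theorem sum_squareWave (n : ℕ) : ∑ d, squareWave n d = 0 := by
  unfold squareWave
  rw [Finset.sum_sub_distrib, sub_eq_zero]
  exact (Equiv.sum_comp (Equiv.neg _) (halfIndicator n)).symm

theorem permWrithe_eq_permPairing (n : ℕ) (π : Equiv.Perm (ZMod (2 * n + 1))) :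
    (permWrithe n π : ℂ) =
      permPairing (circ (halfCoef n)) (circ (fourierCoef (sawtooth n))) π := by
  set T : ZMod (2 * n + 1) → ZMod (2 * n + 1) → ℂ := fun x y =>
    ((SignType.sign (((π y).val : ℝ) - ((π x).val : ℝ)) : ℤ) : ℂ) with hT
  have hTneg : ∀ x y, T y x = - T x y := by
    intro x y
    simp only [hT]
    rw [← neg_sub, Left.sign_neg]
    push_cast
    simp
  have hw : (permWrithe n π : ℂ) = ∑ x, ∑ y, halfIndicator n (y - x) * T x y := by
    unfold permWrithe circleWrithe
    simp only [Int.cast_sum]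
    refine Finset.sum_congr rfl fun x _ => ?_
    rw [← Equiv.sum_comp (Equiv.addLeft x)]
    simp only [Equiv.coe_addLeft, add_sub_cancel_left]
    rw [sum_halfIndicator_mul n (fun d => T x (x + d))]
  have h1 : (permWrithe n π : ℂ) = - ∑ x, ∑ y, halfIndicator n (x - y) * T x y := by
    rw [hw, Finset.sum_comm, ← Finset.sum_neg_distrib]
    refine Finset.sum_congr rfl fun x _ => ?_
    rw [← Finset.sum_neg_distrib]
    refine Finset.sum_congr rfl fun y _ => ?_
    rw [hTneg x y]
    ring
  have h2 : 2 * (permWrithe n π : ℂ) = ∑ x, ∑ y, squareWave n (y - x) * T x y := by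
    rw [two_mul]
    nth_rewrite 1 [hw]
    rw [h1, ← sub_eq_add_neg, ← Finset.sum_sub_distrib]
    refine Finset.sum_congr rfl fun x _ => ?_
    rw [← Finset.sum_sub_distrib]
    refine Finset.sum_congr rfl fun y _ => ?_
    rw [squareWave, neg_sub]
    ring
  have hrow : ∀ x, ∑ y, squareWave n (y - x) = 0 := by
    intro x
    rw [← sum_squareWave n]
    exact Equiv.sum_comp (Equiv.subRight x) (squareWave n)
  have hcol : ∀ y, ∑ x, squareWave n (y - x) = 0 := by
    intro y
    rw [← sum_squareWave n]
    exact Equiv.sum_comp (Equiv.subLeft y) (squareWave n)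
  have h3 : ∑ x, ∑ y, squareWave n (y - x) * T x y =
      ∑ x, ∑ y, squareWave n (y - x) * sawtooth n (π y - π x) := by
    -- The linear correction is a function of `y` minus a function of `x`, so zero column and row
    -- sums annihilate it.
    have hl : ∑ x, ∑ y, squareWave n (y - x) * (((π y).val : ℂ) - (π x).val) = 0 := by
      simp_rw [mul_sub, Finset.sum_sub_distrib, ← Finset.sum_mul, hrow]
      rw [Finset.sum_comm]
      simp_rw [← Finset.sum_mul, hcol]
      simp
    rw [← sub_eq_zero, ← Finset.sum_sub_distrib]
    simp_rw [← Finset.sum_sub_distrib]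
    rw [← mul_zero (2 / ((2 * n + 1 : ℕ) : ℂ)), ← hl, Finset.mul_sum]
    refine Finset.sum_congr rfl fun x _ => ?_
    rw [Finset.mul_sum]
    refine Finset.sum_congr rfl fun y _ => ?_
    rw [sawtooth_sub]
    simp only [hT]
    ring
  have h4 : 2 * permPairing (circ (halfCoef n)) (circ (fourierCoef (sawtooth n))) π =
      ∑ x, ∑ y, squareWave n (y - x) * sawtooth n (π y - π x) := by
    unfold permPairing
    simp_rw [circ_fourierCoef, ← circ_halfCoef_sub, sub_mul, Finset.sum_sub_distrib]
    rw [two_mul, sub_eq_add_neg]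
    congr 1
    -- Exchanging `x` and `y` in the transposed half flips the sign of the sawtooth, so both halves
    -- contribute the same pairing.
    rw [Finset.sum_comm, ← Finset.sum_neg_distrib]
    refine Finset.sum_congr rfl fun x _ => ?_
    rw [← Finset.sum_neg_distrib]
    refine Finset.sum_congr rfl fun y _ => ?_
    rw [← neg_sub (π y) (π x), sawtooth_neg]
    ring
  have h5 := h2.trans (h3.trans h4.symm)
  exact mul_left_cancel₀ two_ne_zero h5

/-! ### Closed forms of the Fourier coefficients -/

theorem stdAddChar_natCast_mul {N : ℕ} [NeZero N] (d p : ℕ) :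
    (ZMod.stdAddChar ((d : ZMod N) * (p : ZMod N)) : ℂ) =
      (ZMod.stdAddChar (p : ZMod N) : ℂ) ^ d := by
  rw [← AddChar.map_nsmul_eq_pow, nsmul_eq_mul]

theorem stdAddChar_natCast {N : ℕ} [NeZero N] (p : ℕ) :
    (ZMod.stdAddChar (p : ZMod N) : ℂ) = Complex.exp (2 * Real.pi * Complex.I * p / N) := by
  have := ZMod.stdAddChar_coe (N := N) (p : ℤ)
  simpa using this

theorem stdAddChar_natCast_ne_one {n p : ℕ} (h1 : 1 ≤ p) (h2 : p ≤ n) :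
    (ZMod.stdAddChar (p : ZMod (2 * n + 1)) : ℂ) ≠ 1 := by
  rw [← AddChar.map_zero_eq_one (ZMod.stdAddChar (N := 2 * n + 1))]
  exact fun h => zmod_natCast_ne_zero h1 h2 (ZMod.injective_stdAddChar h)

theorem stdAddChar_natCast_pow_card {N : ℕ} [NeZero N] (p : ℕ) :
    (ZMod.stdAddChar (p : ZMod N) : ℂ) ^ N = 1 := by
  rw [← AddChar.map_nsmul_eq_pow]
  simp

/-- The square root of `exp (2 π i p / (2 n + 1))` that is a root of unity of odd order. -/
noncomputable def oddRoot (n p : ℕ) : ℂ :=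
  (-1) ^ p * Complex.exp (Real.pi * Complex.I * p / (2 * n + 1 : ℕ))

theorem oddRoot_sq (n p : ℕ) :
    oddRoot n p ^ 2 = ZMod.stdAddChar (p : ZMod (2 * n + 1)) := by
  rw [stdAddChar_natCast, oddRoot, mul_pow, ← pow_mul, mul_comm p 2, pow_mul, neg_one_sq, one_pow,
    one_mul, ← Complex.exp_nat_mul]
  congr 1
  push_cast
  ring

theorem oddRoot_pow (n p : ℕ) : oddRoot n p ^ (2 * n + 1) = 1 := by
  have hN : ((2 * n + 1 : ℕ) : ℂ) ≠ 0 := Nat.cast_ne_zero.mpr (Nat.succ_ne_zero _)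
  rw [oddRoot, mul_pow, ← Complex.exp_nat_mul]
  have : ((2 * n + 1 : ℕ) : ℂ) * (Real.pi * Complex.I * p / (2 * n + 1 : ℕ)) =
      p * (Real.pi * Complex.I) := by
    field_simp
  rw [this, Complex.exp_nat_mul, Complex.exp_pi_mul_I, ← pow_mul, mul_comm p, pow_mul,
    Odd.neg_one_pow ⟨n, rfl⟩, ← mul_pow]
  norm_num

theorem sum_even_pow_mul (v : ℂ) (m : ℕ) :
    (∑ d ∈ Finset.Icc 1 m, v ^ (2 * d)) * (v ^ 2 - 1) = v ^ (2 * m + 2) - v ^ 2 := by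
  induction m with
  | zero => simp
  | succ m ih =>
    rw [Finset.sum_Icc_succ_top (by omega), add_mul, ih]
    ring

/-- The geometric sum telescopes to `v - v^2` because `v^(2n+2) = v`. Cancelling `v - 1` leaves the
half-period sum in closed form, which is why an odd-order square root of the character value is
used. -/
theorem sum_even_pow_mul_of_root {v : ℂ} {n : ℕ} (hv : v ^ (2 * n + 1) = 1) (h1 : v ≠ 1) :
    (∑ d ∈ Finset.Icc 1 n, v ^ (2 * d)) * (v + 1) = - v := by
  have h := sum_even_pow_mul v n
  have h2 : v ^ (2 * n + 2) = v := by rw [pow_succ, hv, one_mul]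
  rw [h2] at h
  refine mul_right_cancel₀ (sub_ne_zero.mpr h1) ?_
  linear_combination h

theorem fourierCoef_squareWave {n p : ℕ} (h1 : 1 ≤ p) (h2 : p ≤ n) :
    fourierCoef (squareWave n) p =
      ((2 * n + 1 : ℕ) : ℂ)⁻¹ * ((oddRoot n p - 1) / (oddRoot n p + 1)) := by
  set v := oddRoot n p with hv
  have hv2 := oddRoot_sq n p
  have hvN := oddRoot_pow n p
  rw [← hv] at hv2 hvN
  have hv0 : v ≠ 0 := by
    intro h
    rw [h, zero_pow (Nat.succ_ne_zero _)] at hvN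
    exact zero_ne_one hvN
  have hv1 : v ≠ 1 := by
    intro h
    rw [h, one_pow] at hv2
    exact stdAddChar_natCast_ne_one h1 h2 hv2.symm
  have hT := sum_even_pow_mul_of_root hvN hv1
  have hS := sum_even_pow_mul_of_root (v := v⁻¹) (n := n) (by rw [inv_pow, hvN, inv_one])
    (by rwa [Ne, inv_eq_one])
  have hvm : v + 1 ≠ 0 := by
    intro h
    rw [h, mul_zero] at hT
    exact hv0 (neg_eq_zero.mp hT.symm)
  have hS' : (∑ d ∈ Finset.Icc 1 n, v⁻¹ ^ (2 * d)) * (v + 1) = -1 := by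
    have h3 : v⁻¹ + 1 = (v + 1) * v⁻¹ := by field_simp; ring
    rw [h3, ← mul_assoc, ← neg_one_mul v⁻¹] at hS
    exact mul_right_cancel₀ (inv_ne_zero hv0) hS
  rw [fourierCoef]
  congr 1
  rw [sum_zmod_eq_sum_Icc]
  have h0 : squareWave n 0 = 0 := by simp [squareWave]
  rw [h0, mul_zero, zero_add, eq_div_iff hvm]
  have hterm : ∀ d ∈ Finset.Icc 1 n,
      (ZMod.stdAddChar (-((d : ZMod (2 * n + 1)) * (p : ZMod (2 * n + 1)))) : ℂ) * squareWave n d +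
        ZMod.stdAddChar (-(-(d : ZMod (2 * n + 1)) * (p : ZMod (2 * n + 1)))) *
          squareWave n (-(d : ZMod (2 * n + 1))) =
      v⁻¹ ^ (2 * d) - v ^ (2 * d) := by
    intro d hd
    rw [Finset.mem_Icc] at hd
    have hs : squareWave n (d : ZMod (2 * n + 1)) = 1 := by
      rw [squareWave, halfIndicator_natCast hd.1 hd.2, halfIndicator_neg_natCast hd.1 hd.2,
        sub_zero]
    rw [squareWave_neg, hs, neg_mul, neg_neg, AddChar.map_neg_eq_inv, stdAddChar_natCast_mul,
      ← hv2, ← pow_mul, inv_pow]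
    ring
  rw [Finset.sum_congr rfl hterm, Finset.sum_sub_distrib, sub_mul, hT, hS']
  ring

theorem sub_one_mul_sum_range_mul_pow (z : ℂ) (m : ℕ) :
    (z - 1) * ∑ d ∈ Finset.range m, (d : ℂ) * z ^ d =
      m * z ^ m - z * ∑ d ∈ Finset.range m, z ^ d := by
  induction m with
  | zero => simp
  | succ m ih =>
    rw [Finset.sum_range_succ, Finset.sum_range_succ, mul_add, ih]
    push_cast
    ring

theorem fourierCoef_sawtooth {n p : ℕ} (h1 : 1 ≤ p) (h2 : p ≤ n) :
    fourierCoef (sawtooth n) p = - (((2 * n + 1 : ℕ) : ℂ)⁻¹ *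
      (((ZMod.stdAddChar (p : ZMod (2 * n + 1)) : ℂ)⁻¹ + 1) /
        ((ZMod.stdAddChar (p : ZMod (2 * n + 1)) : ℂ)⁻¹ - 1))) := by
  have hN : ((2 * n + 1 : ℕ) : ℂ) ≠ 0 := Nat.cast_ne_zero.mpr (Nat.succ_ne_zero _)
  set z : ℂ := (ZMod.stdAddChar (p : ZMod (2 * n + 1)) : ℂ)⁻¹ with hz
  have hz1 : z ≠ 1 := by
    rw [hz, Ne, inv_eq_one]
    exact stdAddChar_natCast_ne_one h1 h2
  have hzN : z ^ (2 * n + 1) = 1 := by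
    rw [hz, inv_pow, stdAddChar_natCast_pow_card, inv_one]
  have hgeom : ∑ d ∈ Finset.range (2 * n + 1), z ^ d = 0 := by
    rw [geom_sum_eq hz1, hzN, sub_self, zero_div]
  have hlin := sub_one_mul_sum_range_mul_pow z (2 * n + 1)
  rw [hgeom, hzN, mul_zero, sub_zero, mul_one] at hlin
  rw [fourierCoef, ← mul_neg]
  congr 1
  rw [sum_zmod_eq_sum_range]
  -- The affine formula would give 1 at `d = 0`, where the sawtooth is 0; the last term corrects
  -- this.
  have hterm : ∀ d ∈ Finset.range (2 * n + 1),
      (ZMod.stdAddChar (-((d : ZMod (2 * n + 1)) * (p : ZMod (2 * n + 1)))) : ℂ) * sawtooth n d =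
      (z ^ d - 2 / ((2 * n + 1 : ℕ) : ℂ) * (d * z ^ d)) - if d = 0 then 1 else 0 := by
    intro d hd
    rw [Finset.mem_range] at hd
    rw [AddChar.map_neg_eq_inv, stdAddChar_natCast_mul, ← inv_pow, ← hz, sawtooth]
    by_cases h0 : d = 0
    · simp [h0]
    · have : (d : ZMod (2 * n + 1)) ≠ 0 := by
        rw [Ne, ZMod.natCast_eq_zero_iff]
        exact Nat.not_dvd_of_pos_of_lt (by omega) hd
      rw [if_neg this, if_neg h0, ZMod.val_natCast_of_lt hd]
      ring
  rw [Finset.sum_congr rfl hterm, Finset.sum_sub_distrib, Finset.sum_sub_distrib, hgeom,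
    ← Finset.mul_sum]
  have hz1' : z - 1 ≠ 0 := sub_ne_zero.mpr hz1
  have hlin' : ∑ d ∈ Finset.range (2 * n + 1), (d : ℂ) * z ^ d = ((2 * n + 1 : ℕ) : ℂ) / (z - 1) := by
    rw [eq_div_iff hz1', mul_comm]
    exact hlin
  rw [hlin']
  simp only [Finset.sum_ite_eq', Finset.mem_range, Nat.succ_pos, if_true]
  field_simp
  ring

/-! ### Uniform bounds for the Fourier coefficients -/

theorem two_mul_div_le_norm_exp_sub_one {t : ℝ} (h0 : 0 ≤ t) (h1 : t ≤ Real.pi) :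
    2 * t / Real.pi ≤ ‖Complex.exp (Complex.I * t) - 1‖ := by
  rw [Complex.norm_exp_I_mul_ofReal_sub_one]
  have h := Real.mul_le_sin (x := t / 2) (by linarith) (by linarith)
  rw [Real.norm_eq_abs]
  refine le_trans ?_ (le_abs_self _)
  calc 2 * t / Real.pi = 2 * (2 / Real.pi * (t / 2)) := by ring
    _ ≤ _ := by linarith

theorem norm_exp_I_mul (t : ℝ) : ‖Complex.exp (Complex.I * t)‖ = 1 := by
  rw [mul_comm]
  exact Complex.norm_exp_ofReal_mul_I t

theorem oddRoot_eq (n p : ℕ) :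
    oddRoot n p = (-1) ^ p * Complex.exp (Complex.I * ((Real.pi * p / (2 * n + 1 : ℕ) : ℝ) : ℂ)) := by
  rw [oddRoot]
  congr 2
  push_cast
  ring

/-- For even `p` the root has argument in `[0, π/2]`, so the denominator `v + 1` stays away from
zero. These coefficients vanish in the limit. -/
theorem norm_fourierCoef_squareWave_le_of_even {n p : ℕ} (h1 : 1 ≤ p) (h2 : p ≤ n)
    (hp : Even p) : ‖fourierCoef (squareWave n) p‖ ≤ 2 / (2 * n + 1 : ℕ) := by
  have hN : (0 : ℝ) < (2 * n + 1 : ℕ) := by positivity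
  rw [fourierCoef_squareWave h1 h2, oddRoot_eq, hp.neg_one_pow, one_mul, norm_mul, norm_inv,
    Complex.norm_natCast, norm_div, inv_mul_eq_div]
  set t : ℝ := Real.pi * p / (2 * n + 1 : ℕ) with ht
  have ht0 : 0 ≤ t := by positivity
  have ht1 : t ≤ Real.pi / 2 := by
    rw [ht, div_le_div_iff₀ hN two_pos, mul_assoc]
    refine mul_le_mul_of_nonneg_left ?_ Real.pi_pos.le
    exact_mod_cast (by omega : p * 2 ≤ 2 * n + 1)
  have hnum : ‖Complex.exp (Complex.I * t) - 1‖ ≤ 2 := by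
    refine (norm_sub_le _ _).trans ?_
    rw [norm_exp_I_mul, norm_one]
    norm_num
  have hden : 1 ≤ ‖Complex.exp (Complex.I * t) + 1‖ := by
    refine le_trans ?_ (Complex.re_le_norm _)
    rw [mul_comm, Complex.add_re, Complex.exp_ofReal_mul_I_re, Complex.one_re]
    have := Real.cos_nonneg_of_neg_pi_div_two_le_of_le (x := t) (by linarith [Real.pi_pos]) ht1
    linarith
  refine div_le_div_of_nonneg_right ?_ hN.le
  rw [div_le_iff₀ (by linarith)]
  linarith

theorem norm_fourierCoef_squareWave_le {n p : ℕ} (h1 : 1 ≤ p) (h2 : p ≤ n) :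
    ‖fourierCoef (squareWave n) p‖ ≤ 1 / p := by
  have hN : (0 : ℝ) < (2 * n + 1 : ℕ) := by positivity
  have hp0 : (0 : ℝ) < p := by exact_mod_cast h1
  rcases Nat.even_or_odd p with hp | hp
  · refine (norm_fourierCoef_squareWave_le_of_even h1 h2 hp).trans ?_
    rw [div_le_div_iff₀ hN hp0, one_mul]
    exact_mod_cast (by omega : 2 * p ≤ 2 * n + 1)
  · rw [fourierCoef_squareWave h1 h2, oddRoot_eq, hp.neg_one_pow, neg_one_mul, norm_mul, norm_inv,
      Complex.norm_natCast, norm_div, inv_mul_eq_div]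
    set t : ℝ := Real.pi * p / (2 * n + 1 : ℕ) with ht
    have ht0 : 0 ≤ t := by positivity
    have ht1 : t ≤ Real.pi := by
      rw [ht, div_le_iff₀ hN]
      refine mul_le_mul_of_nonneg_left ?_ Real.pi_pos.le
      exact_mod_cast (by omega : p ≤ 2 * n + 1)
    have hnum : ‖-Complex.exp (Complex.I * t) - 1‖ ≤ 2 := by
      refine (norm_sub_le _ _).trans ?_
      rw [norm_neg, norm_exp_I_mul, norm_one]
      norm_num
    have hden := two_mul_div_le_norm_exp_sub_one ht0 ht1
    have hden' : 2 * t / Real.pi = 2 * p / (2 * n + 1 : ℕ) := by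
      rw [ht]
      field_simp
    rw [hden'] at hden
    have hd0 : 0 < 2 * (p : ℝ) / (2 * n + 1 : ℕ) := by positivity
    -- For odd `p` the denominator is a chord of the unit circle, of length at least `2p/N` by
    -- Jordan's inequality.
    have hflip : ‖-Complex.exp (Complex.I * t) + 1‖ = ‖Complex.exp (Complex.I * t) - 1‖ := by
      rw [← norm_neg]
      congr 1
      ring
    rw [hflip]
    calc ‖-Complex.exp (Complex.I * t) - 1‖ / ‖Complex.exp (Complex.I * t) - 1‖ /
          ((2 * n + 1 : ℕ) : ℝ) ≤ 2 / (2 * (p : ℝ) / (2 * n + 1 : ℕ)) / (2 * n + 1 : ℕ) := by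
          gcongr
      _ = 1 / p := by field_simp

theorem stdAddChar_inv_eq (n p : ℕ) : (ZMod.stdAddChar (p : ZMod (2 * n + 1)) : ℂ)⁻¹ =
    (Complex.exp (Complex.I * ((2 * Real.pi * p / (2 * n + 1 : ℕ) : ℝ) : ℂ)))⁻¹ := by
  rw [stdAddChar_natCast]
  congr 2
  push_cast
  ring

theorem norm_fourierCoef_sawtooth_le {n p : ℕ} (h1 : 1 ≤ p) (h2 : p ≤ n) :
    ‖fourierCoef (sawtooth n) p‖ ≤ 1 / (2 * p) := by
  have hN : (0 : ℝ) < (2 * n + 1 : ℕ) := by positivity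
  have hp0 : (0 : ℝ) < p := by exact_mod_cast h1
  rw [fourierCoef_sawtooth h1 h2, stdAddChar_inv_eq, norm_neg, norm_mul, norm_inv,
    Complex.norm_natCast, norm_div, inv_mul_eq_div]
  set t : ℝ := 2 * Real.pi * p / (2 * n + 1 : ℕ) with ht
  have ht0 : 0 ≤ t := by positivity
  have ht1 : t ≤ Real.pi := by
    rw [ht, div_le_iff₀ hN, mul_comm 2, mul_assoc]
    refine mul_le_mul_of_nonneg_left ?_ Real.pi_pos.le
    exact_mod_cast (by omega : 2 * p ≤ 2 * n + 1)
  have hnum : ‖(Complex.exp (Complex.I * t))⁻¹ + 1‖ ≤ 2 := by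
    refine (norm_add_le _ _).trans ?_
    rw [norm_inv, norm_exp_I_mul, norm_one]
    norm_num
  have hden := two_mul_div_le_norm_exp_sub_one ht0 ht1
  have hden' : 2 * t / Real.pi = 4 * p / (2 * n + 1 : ℕ) := by
    rw [ht]
    field_simp
    norm_num
  rw [hden'] at hden
  have hd0 : 0 < 4 * (p : ℝ) / (2 * n + 1 : ℕ) := by positivity
  have hflip : ‖(Complex.exp (Complex.I * t))⁻¹ - 1‖ = ‖Complex.exp (Complex.I * t) - 1‖ := by
    have h3 : (Complex.exp (Complex.I * t))⁻¹ - 1 =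
        -((Complex.exp (Complex.I * t) - 1) * (Complex.exp (Complex.I * t))⁻¹) := by
      have := Complex.exp_ne_zero (Complex.I * t)
      field_simp
      ring
    rw [h3, norm_neg, norm_mul, norm_inv, norm_exp_I_mul, inv_one, mul_one]
  rw [hflip]
  calc ‖(Complex.exp (Complex.I * t))⁻¹ + 1‖ / ‖Complex.exp (Complex.I * t) - 1‖ /
        ((2 * n + 1 : ℕ) : ℝ) ≤ 2 / (4 * (p : ℝ) / (2 * n + 1 : ℕ)) / (2 * n + 1 : ℕ) := by
        gcongr
    _ = 1 / (2 * p) := by field_simp; norm_num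

open Filter Topology

/-! ### Limits of the Fourier coefficients and of their power sums -/

theorem tendsto_natCast_odd_inv :
    Tendsto (fun n : ℕ => (((2 * n + 1 : ℕ) : ℂ))⁻¹) atTop (𝓝 0) := by
  have h1 : Tendsto (fun n : ℕ => 2 * n + 1) atTop atTop :=
    tendsto_atTop_mono (fun n => (by omega : n ≤ 2 * n + 1)) tendsto_id
  exact (tendsto_inv_atTop_nhds_zero_nat (𝕜 := ℂ)).comp h1

theorem tendsto_mul_exp_div_sub_one (c : ℂ) :
    Tendsto (fun n : ℕ => ((2 * n + 1 : ℕ) : ℂ) * (Complex.exp (c / (2 * n + 1 : ℕ)) - 1)) atTop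
      (𝓝 c) := by
  have hd : HasDerivAt (fun t : ℂ => Complex.exp (c * t)) c 0 := by
    have := ((hasDerivAt_id (0 : ℂ)).const_mul c).cexp
    simpa using this
  have h := hd.tendsto_slope_zero
  have h2 : Tendsto (fun n : ℕ => (((2 * n + 1 : ℕ) : ℂ))⁻¹) atTop (𝓝[≠] 0) := by
    refine tendsto_nhdsWithin_iff.mpr ⟨tendsto_natCast_odd_inv, Eventually.of_forall fun n => ?_⟩
    exact inv_ne_zero (Nat.cast_ne_zero.mpr (Nat.succ_ne_zero _))
  refine (h.comp h2).congr fun n => ?_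
  simp [div_eq_mul_inv]

theorem tendsto_exp_div (c : ℂ) :
    Tendsto (fun n : ℕ => Complex.exp (c / (2 * n + 1 : ℕ))) atTop (𝓝 1) := by
  have h := (tendsto_natCast_odd_inv.const_mul c).cexp
  rw [mul_zero, Complex.exp_zero] at h
  exact h

theorem tendsto_fourierCoef_squareWave {p : ℕ} (hp : 1 ≤ p) :
    Tendsto (fun n : ℕ => fourierCoef (squareWave n) p) atTop
      (𝓝 (if Odd p then 2 / (Real.pi * Complex.I * p) else 0)) := by
  split_ifs with hodd
  · have hc : (Real.pi * Complex.I * p : ℂ) ≠ 0 := by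
      have : (p : ℂ) ≠ 0 := Nat.cast_ne_zero.mpr (by omega)
      simp [Real.pi_ne_zero, Complex.I_ne_zero, this]
    have h1 := ((tendsto_exp_div (Real.pi * Complex.I * p)).add_const 1).div
      (tendsto_mul_exp_div_sub_one (Real.pi * Complex.I * p)) hc
    rw [one_add_one_eq_two] at h1
    refine h1.congr' ?_
    filter_upwards [eventually_ge_atTop p] with n hn
    rw [fourierCoef_squareWave hp hn, oddRoot, hodd.neg_one_pow]
    simp only [Pi.div_apply]
    rw [show ∀ e : ℂ, -1 * e - 1 = -(e + 1) from fun e => by ring,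
      show ∀ e : ℂ, -1 * e + 1 = -(e - 1) from fun e => by ring, neg_div_neg_eq,
      ← div_div, inv_mul_eq_div, div_right_comm]
  · have h1 := tendsto_natCast_odd_inv.norm.const_mul 2
    rw [norm_zero, mul_zero] at h1
    refine squeeze_zero_norm' ?_ h1
    filter_upwards [eventually_ge_atTop p] with n hn
    refine (norm_fourierCoef_squareWave_le_of_even hp hn (Nat.not_odd_iff_even.mp hodd)).trans ?_
    rw [norm_inv, Complex.norm_natCast, div_eq_mul_inv]

theorem tendsto_fourierCoef_sawtooth {p : ℕ} (hp : 1 ≤ p) :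
    Tendsto (fun n : ℕ => fourierCoef (sawtooth n) p) atTop
      (𝓝 (1 / (Real.pi * Complex.I * p))) := by
  have hp0 : (p : ℂ) ≠ 0 := Nat.cast_ne_zero.mpr (by omega)
  have hc : (-(2 * Real.pi * Complex.I * p) : ℂ) ≠ 0 := by
    simp [Real.pi_ne_zero, Complex.I_ne_zero, hp0]
  have h1 := (((tendsto_exp_div (-(2 * Real.pi * Complex.I * p))).add_const 1).div
    (tendsto_mul_exp_div_sub_one (-(2 * Real.pi * Complex.I * p))) hc).neg
  have hlim : -((1 + 1) / (-(2 * Real.pi * Complex.I * p) : ℂ)) =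
      1 / (Real.pi * Complex.I * p) := by
    have hpi : (Real.pi : ℂ) ≠ 0 := by exact_mod_cast Real.pi_ne_zero
    have := Complex.I_ne_zero
    field_simp
    norm_num
  rw [hlim] at h1
  refine h1.congr' ?_
  filter_upwards [eventually_ge_atTop p] with n hn
  rw [fourierCoef_sawtooth hp hn, stdAddChar_natCast, ← Complex.exp_neg, ← neg_div]
  simp only [Pi.div_apply]
  rw [← div_div, inv_mul_eq_div, div_right_comm]

/-- Dominated convergence with majorant `1/p^l`, which is summable only for `l ≥ 2`; length 1 is odd
and needs no limit. The condition `g 0 = 0` removes the index 0 from the series. -/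
theorem tendsto_sum_Icc_pow {c : ℕ → ℕ → ℂ} {g : ℕ → ℂ} {l : ℕ} (hl : 2 ≤ l)
    (hc : ∀ n p, 1 ≤ p → p ≤ n → ‖c n p‖ ≤ 1 / p) (hg0 : g 0 = 0)
    (hg : ∀ p, 1 ≤ p → Tendsto (fun n => c n p) atTop (𝓝 (g p))) :
    Tendsto (fun n => ∑ p ∈ Finset.Icc 1 n, c n p ^ l) atTop (𝓝 (∑' p, g p ^ l)) := by
  have hsum : ∀ n, ∑ p ∈ Finset.Icc 1 n, c n p ^ l =
      ∑' p, if p ∈ Finset.Icc 1 n then c n p ^ l else 0 := by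
    intro n
    rw [tsum_eq_sum (s := Finset.Icc 1 n) fun p hp => if_neg hp]
    exact Finset.sum_congr rfl fun p hp => (if_pos hp).symm
  simp_rw [hsum]
  refine tendsto_tsum_of_dominated_convergence (bound := fun p : ℕ => 1 / (p : ℝ) ^ l)
    (Real.summable_one_div_nat_pow.mpr (by omega)) (fun p => ?_)
    (Eventually.of_forall fun n p => ?_)
  · rcases Nat.eq_zero_or_pos p with rfl | hp
    · simp [hg0, show l ≠ 0 by omega]
    · refine ((hg p hp).pow l).congr' ?_
      filter_upwards [eventually_ge_atTop p] with n hn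
      rw [if_pos (Finset.mem_Icc.mpr ⟨hp, hn⟩)]
  · split_ifs with h
    · rw [Finset.mem_Icc] at h
      rw [norm_pow, ← one_div_pow]
      exact pow_le_pow_left₀ (norm_nonneg _) (hc n p h.1 h.2) l
    · rw [norm_zero]
      positivity

theorem sum_halfCoef_pow (n : ℕ) {l : ℕ} (hl : l ≠ 0) :
    ∑ p, halfCoef n p ^ l = ∑ p ∈ Finset.Icc 1 n, fourierCoef (squareWave n) p ^ l := by
  rw [← sum_halfIndicator_mul n fun p => fourierCoef (squareWave n) p ^ l]
  refine Finset.sum_congr rfl fun p _ => ?_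
  rw [halfCoef, mul_pow]
  congr 1
  unfold halfIndicator
  split_ifs <;> simp [hl]

/-- Opposite frequencies carry opposite coefficients, hence the sum doubles for even `l` and cancels
for odd `l`. -/
theorem sum_fourierCoef_sawtooth_pow (n : ℕ) {l : ℕ} (hl : l ≠ 0) :
    ∑ p, fourierCoef (sawtooth n) p ^ l =
      (1 + (-1) ^ l) * ∑ p ∈ Finset.Icc 1 n, fourierCoef (sawtooth n) p ^ l := by
  rw [sum_zmod_eq_sum_Icc, fourierCoef_zero (sawtooth_neg n), zero_pow hl, zero_add,
    Finset.mul_sum]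
  refine Finset.sum_congr rfl fun p _ => ?_
  rw [fourierCoef_neg (sawtooth_neg n), neg_pow]
  ring

theorem hasSum_odd_zeta {m : ℕ} {Z : ℝ}
    (hZ : HasSum (fun p : ℕ => 1 / (p : ℝ) ^ (2 * m)) Z) :
    HasSum (fun p : ℕ => if Odd p then 1 / (p : ℝ) ^ (2 * m) else 0)
      ((1 - 1 / 2 ^ (2 * m)) * Z) := by
  have heven : HasSum (fun p : ℕ => if Even p then 1 / (p : ℝ) ^ (2 * m) else 0)
      (1 / 2 ^ (2 * m) * Z) := by
    have hinj : Function.Injective fun p : ℕ => 2 * p := fun a b h => by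
      simpa using h
    rw [← hinj.hasSum_iff]
    · refine Eq.mp (congrArg (fun f => HasSum f _) (funext fun p => ?_))
        (hZ.mul_left (1 / 2 ^ (2 * m)))
      simp only [Function.comp_apply, even_two_mul, if_true]
      push_cast
      rw [mul_pow]
      field_simp
    · intro p hp
      rw [if_neg]
      intro he
      obtain ⟨q, hq⟩ := even_iff_exists_two_mul.mp he
      exact hp ⟨q, hq.symm⟩
  rw [sub_mul, one_mul]
  refine Eq.mp (congrArg (fun f => HasSum f _) (funext fun p => ?_)) (hZ.sub heven)
  rcases Nat.even_or_odd p with h | h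
  · rw [if_neg (Nat.not_odd_iff_even.mpr h), if_pos h, sub_self]
  · rw [if_pos h, if_neg (Nat.not_even_iff_odd.mpr h), sub_zero]

theorem tendsto_powerSum_mul {l : ℕ} (hl : l ≠ 0) :
    Tendsto (fun n : ℕ => (∑ p, halfCoef n p ^ l) * ∑ p, fourierCoef (sawtooth n) p ^ l) atTop
      (𝓝 ((cycleWeight l / 2 ^ l : ℝ) : ℂ)) := by
  simp_rw [sum_halfCoef_pow _ hl, sum_fourierCoef_sawtooth_pow _ hl]
  rcases Nat.even_or_odd l with he | ho
  · obtain ⟨m, rfl⟩ := even_iff_exists_two_mul.mp he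
    have hm : m ≠ 0 := by rintro rfl; exact hl rfl
    have h1 := tendsto_sum_Icc_pow (c := fun n p => fourierCoef (squareWave n) p)
      (l := 2 * m) (by omega) (fun n p => norm_fourierCoef_squareWave_le)
      (g := fun p => if Odd p then 2 / (Real.pi * Complex.I * p) else 0) (by simp)
      (fun p => tendsto_fourierCoef_squareWave)
    have h2 := tendsto_sum_Icc_pow (c := fun n p => fourierCoef (sawtooth n) p)
      (l := 2 * m) (by omega)
      (fun n p hp hpn => (norm_fourierCoef_sawtooth_le hp hpn).trans (by
        have : (0 : ℝ) < p := by exact_mod_cast hp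
        exact one_div_le_one_div_of_le this (by linarith)))
      (g := fun p => 1 / (Real.pi * Complex.I * p)) (by simp)
      (fun p => tendsto_fourierCoef_sawtooth)
    have hZ := hasSum_zeta_nat hm
    set Z : ℝ := (-1) ^ (m + 1) * 2 ^ (2 * m - 1) * Real.pi ^ (2 * m) * bernoulli (2 * m) /
      (2 * m).factorial with hZdef
    have hpi : (Real.pi : ℂ) ≠ 0 := by exact_mod_cast Real.pi_ne_zero
    have hI : ∀ p : ℂ, (Real.pi * Complex.I * p) ^ (2 * m) =
        (-1) ^ m * Real.pi ^ (2 * m) * p ^ (2 * m) := by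
      intro p
      rw [mul_pow, mul_pow, pow_mul Complex.I, Complex.I_sq]
      ring
    have hneg : ((-1 : ℂ) ^ m) * (-1) ^ m = 1 := by rw [← mul_pow]; norm_num
    have hinv : ((-1 : ℂ) ^ m)⁻¹ = (-1) ^ m := inv_eq_of_mul_eq_one_left hneg
    have hs2 : ∑' p : ℕ, (1 / (Real.pi * Complex.I * p : ℂ)) ^ (2 * m) =
        (-1) ^ m / Real.pi ^ (2 * m) * Z := by
      rw [← ((Complex.hasSum_ofReal.mpr hZ).mul_left _).tsum_eq]
      refine tsum_congr fun p => ?_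
      rw [div_pow, one_pow, hI]
      push_cast
      simp only [div_eq_mul_inv, mul_inv, hinv]
      ring
    have hs1 : ∑' p : ℕ, (if Odd p then 2 / (Real.pi * Complex.I * p : ℂ) else 0) ^ (2 * m) =
        2 ^ (2 * m) * (-1) ^ m / Real.pi ^ (2 * m) * ((1 - 1 / 2 ^ (2 * m)) * Z : ℝ) := by
      rw [← ((Complex.hasSum_ofReal.mpr (hasSum_odd_zeta hZ)).mul_left _).tsum_eq]
      refine tsum_congr fun p => ?_
      split_ifs with hp
      · rw [div_pow, hI]
        push_cast
        simp only [div_eq_mul_inv, mul_inv, hinv]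
        ring
      · simp [hl]
    rw [hs1] at h1
    rw [hs2] at h2
    have h3 := h1.mul (h2.const_mul (1 + (-1) ^ (2 * m)))
    convert h3 using 2
    -- Both limits are multiples of the zeta value `Z`, the square wave seeing only odd frequencies.
    -- Euler's formula for `Z` turns `Z^2` into the squared Bernoulli number and cancels the powers
    -- of `π`.
    have hreal : cycleWeight (2 * m) / 2 ^ (2 * m) =
        2 * 2 ^ (2 * m) / (Real.pi ^ (2 * m)) ^ 2 * (1 - 1 / 2 ^ (2 * m)) * Z ^ 2 := by
      have hpiR : Real.pi ^ (2 * m) ≠ 0 := pow_ne_zero _ Real.pi_ne_zero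
      have hF : ((2 * m).factorial : ℝ) ≠ 0 := Nat.cast_ne_zero.mpr (Nat.factorial_ne_zero _)
      have h8 : (8 : ℝ) ^ (2 * m) = (2 ^ (2 * m)) ^ 3 := by
        rw [pow_right_comm]
        norm_num
      have hhalf : (2 : ℝ) ^ (2 * m - 1) = 2 ^ (2 * m) / 2 := by
        rw [eq_div_iff two_ne_zero, ← pow_succ]
        congr 1
        omega
      have hsgn : ((-1 : ℝ) ^ (m + 1)) ^ 2 = 1 := by
        rw [← pow_mul, mul_comm, pow_mul]
        norm_num
      have hx : (2 : ℝ) ^ (2 * m) ≠ 0 := by positivity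
      rw [cycleWeight, if_pos he, hZdef, h8, hhalf, div_pow, mul_pow, mul_pow, mul_pow, hsgn]
      field_simp
    rw [hreal, pow_mul (-1 : ℂ) 2 m, neg_one_sq, one_pow]
    push_cast
    linear_combination (-(2 * 2 ^ (2 * m) / ((Real.pi : ℂ) ^ (2 * m)) ^ 2 *
      (1 - 1 / 2 ^ (2 * m)) * (Z : ℂ) ^ 2)) * hneg
  · simp [ho.neg_one_pow, cycleWeight, Nat.not_even_iff_odd.mpr ho]

/-! ### The limit of the moments -/

theorem uniformExpectation_eq {α : Type*} [Fintype α] [Nonempty α] (X : α → ℝ) :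
    uniformExpectation X = (∑ a, X a) / Fintype.card α := by
  let _ : MeasurableSpace α := ⊤
  have : DiscreteMeasurableSpace α := ⟨fun _ => trivial⟩
  unfold uniformExpectation
  rw [PMF.integral_eq_sum]
  simp only [PMF.uniformOfFintype_apply, ENNReal.toReal_inv, ENNReal.toReal_natCast, smul_eq_mul]
  rw [← Finset.mul_sum, inv_mul_eq_div]

theorem sum_Icc_one_div_le (n : ℕ) : ∑ p ∈ Finset.Icc 1 n, 1 / (p : ℝ) ≤ 1 + Real.log n := by
  have h := harmonic_le_one_add_log n
  rw [harmonic_eq_sum_Icc] at h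
  push_cast at h
  simpa using h

theorem sum_norm_halfCoef_le (n : ℕ) : ∑ p, ‖halfCoef n p‖ ≤ 1 + Real.log n := by
  refine le_trans ?_ (sum_Icc_one_div_le n)
  rw [sum_zmod_eq_sum_Icc]
  have h0 : halfCoef n 0 = 0 := by simp [halfCoef, halfIndicator]
  rw [h0, norm_zero, zero_add]
  refine Finset.sum_le_sum fun p hp => ?_
  rw [Finset.mem_Icc] at hp
  rw [halfCoef, halfCoef, halfIndicator_natCast hp.1 hp.2, halfIndicator_neg_natCast hp.1 hp.2,
    one_mul, zero_mul, norm_zero, add_zero]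
  exact norm_fourierCoef_squareWave_le hp.1 hp.2

theorem sum_norm_fourierCoef_sawtooth_le (n : ℕ) :
    ∑ p, ‖fourierCoef (sawtooth n) p‖ ≤ 1 + Real.log n := by
  refine le_trans ?_ (sum_Icc_one_div_le n)
  rw [sum_zmod_eq_sum_Icc, fourierCoef_zero (sawtooth_neg n), norm_zero, zero_add]
  refine Finset.sum_le_sum fun p hp => ?_
  rw [Finset.mem_Icc] at hp
  rw [fourierCoef_neg (sawtooth_neg n), norm_neg]
  have h := norm_fourierCoef_sawtooth_le hp.1 hp.2
  calc _ ≤ 1 / (2 * (p : ℝ)) + 1 / (2 * p) := add_le_add h h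
    _ = 1 / p := by
      have : (p : ℝ) ≠ 0 := Nat.cast_ne_zero.mpr (by omega)
      field_simp
      norm_num

theorem tendsto_one_add_log_pow_div (j : ℕ) :
    Tendsto (fun n : ℕ => (1 + Real.log n) ^ j / ((2 * n + 1 : ℕ) : ℝ)) atTop (𝓝 0) := by
  have he : (2 / Real.exp 1) ≠ 0 := (div_pos two_pos (Real.exp_pos 1)).ne'
  -- Evaluated at `e * n`, since `log (e * n) = 1 + log n`; the slope `2/e` turns the denominator
  -- into `2n + 1`.
  have h := Real.tendsto_pow_log_div_mul_add_atTop (2 / Real.exp 1) 1 j he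
  have hx : Tendsto (fun n : ℕ => Real.exp 1 * (n : ℝ)) atTop atTop :=
    tendsto_natCast_atTop_atTop.const_mul_atTop (Real.exp_pos 1)
  refine (h.comp hx).congr' ?_
  filter_upwards [eventually_ge_atTop 1] with n hn
  have hn0 : (n : ℝ) ≠ 0 := Nat.cast_ne_zero.mpr (by omega)
  have hexp := (Real.exp_pos 1).ne'
  simp only [Function.comp_apply]
  rw [Real.log_mul hexp hn0, Real.log_exp]
  congr 1
  push_cast
  field_simp

theorem tendsto_sum_perm_prod (k : ℕ) :
    Tendsto (fun n : ℕ => ∑ σ : Equiv.Perm (Fin k), (σ.partition.parts.map fun l =>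
        (∑ p, halfCoef n p ^ l) * ∑ p, fourierCoef (sawtooth n) p ^ l).prod) atTop
      (𝓝 (∑ σ : Equiv.Perm (Fin k), (σ.partition.parts.map fun l =>
        ((cycleWeight l / 2 ^ l : ℝ) : ℂ)).prod)) := by
  refine tendsto_finsetSum _ fun σ _ => ?_
  exact tendsto_multiset_prod _ fun l hl =>
    tendsto_powerSum_mul (σ.partition.parts_pos hl).ne'

theorem tendsto_moment (k : ℕ) :
    Tendsto (fun n : ℕ => (∑ π : Equiv.Perm (ZMod (2 * n + 1)),
        ((permWrithe n π : ℂ) / (2 * n + 1 : ℕ)) ^ k) /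
        (Fintype.card (Equiv.Perm (ZMod (2 * n + 1))) : ℂ)) atTop
      (𝓝 (∑ σ : Equiv.Perm (Fin k), (σ.partition.parts.map fun l =>
        ((cycleWeight l / 2 ^ l : ℝ) : ℂ)).prod)) := by
  have hdiff : Tendsto (fun n : ℕ => (∑ π : Equiv.Perm (ZMod (2 * n + 1)),
        ((permWrithe n π : ℂ) / (2 * n + 1 : ℕ)) ^ k) /
        (Fintype.card (Equiv.Perm (ZMod (2 * n + 1))) : ℂ) -
      ∑ σ : Equiv.Perm (Fin k), (σ.partition.parts.map fun l =>
        (∑ p, halfCoef n p ^ l) * ∑ p, fourierCoef (sawtooth n) p ^ l).prod) atTop (𝓝 0) := by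
    have hbound := (tendsto_one_add_log_pow_div (2 * k)).const_mul
      (Fintype.card (Setoid (Fin k ⊕ Fin k)) *
        (3 * (k : ℝ) ^ 2 + ((2 * k).factorial : ℝ) ^ 2 * 4 ^ k))
    rw [mul_zero] at hbound
    refine squeeze_zero_norm' ?_ hbound
    filter_upwards [eventually_ge_atTop (4 * k)] with n hn
    simp_rw [permWrithe_eq_permPairing]
    refine norm_moment_circ_sub_le ?_ (fourierCoef_zero (sawtooth_neg n)) (fun p => ?_)
      (sum_norm_halfCoef_le n) (sum_norm_fourierCoef_sawtooth_le n) k (by omega)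
    · simp [halfCoef, halfIndicator]
    · rw [halfCoef, halfCoef]
      linear_combination fourierCoef (squareWave n) p * fourierCoef (squareWave n) (-p) *
        halfIndicator_mul_neg n p
  have h := hdiff.add (tendsto_sum_perm_prod k)
  rw [zero_add] at h
  refine h.congr fun n => ?_
  ring

theorem theorem1 (k : ℕ) :
    Filter.Tendsto
      (fun n : ℕ => uniformExpectation
        fun π : Equiv.Perm (ZMod (2 * n + 1)) => ((permWrithe n π : ℝ) / (n : ℝ)) ^ k)
      Filter.atTop
      (nhds (∑ σ : Equiv.Perm (Fin k), ((cycleLengths σ).map cycleWeight).prod)) := by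
  have hratio : Tendsto (fun n : ℕ => (((2 * n + 1 : ℕ) : ℂ) / (n : ℂ)) ^ k) atTop
      (𝓝 (2 ^ k)) := by
    refine Tendsto.pow ?_ k
    have h := (tendsto_inv_atTop_nhds_zero_nat (𝕜 := ℂ)).const_add 2
    rw [add_zero] at h
    refine h.congr' ?_
    filter_upwards [eventually_ge_atTop 1] with n hn
    have hn0 : (n : ℂ) ≠ 0 := Nat.cast_ne_zero.mpr (by omega)
    push_cast
    field_simp
  have hmain := hratio.mul (tendsto_moment k)
  have hlim : (2 : ℂ) ^ k * ∑ σ : Equiv.Perm (Fin k), (σ.partition.parts.map fun l =>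
        ((cycleWeight l / 2 ^ l : ℝ) : ℂ)).prod =
      ((∑ σ : Equiv.Perm (Fin k), ((cycleLengths σ).map cycleWeight).prod : ℝ) : ℂ) := by
    rw [Finset.mul_sum]
    push_cast
    refine Finset.sum_congr rfl fun σ _ => ?_
    have hsum : (σ.partition.parts).sum = k := by
      rw [σ.partition.parts_sum, Fintype.card_fin]
    -- The cycle lengths add up to `k`, so the global factor `2^k` splits into one factor `2^l` per
    -- cycle.
    have hpow : (2 : ℂ) ^ k = (σ.partition.parts.map fun l => (2 : ℂ) ^ l).prod := by
      conv_lhs => rw [← hsum]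
      induction σ.partition.parts using Multiset.induction_on with
      | empty => simp
      | cons l s ih => simp [pow_add, ih]
    rw [hpow, ← Multiset.prod_map_mul, cycleLengths]
    have hcast : (((σ.partition.parts.map cycleWeight).prod : ℝ) : ℂ) =
        (σ.partition.parts.map fun l => (cycleWeight l : ℂ)).prod := by
      rw [← Complex.ofRealHom_eq_coe, map_multiset_prod, Multiset.map_map]
      rfl
    rw [hcast]
    congr 1
    refine Multiset.map_congr rfl fun l _ => ?_
    field_simp
  rw [hlim] at hmain
  refine tendsto_ofReal_iff.mp ?_
  refine hmain.congr fun n => ?_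
  rw [uniformExpectation_eq]
  push_cast
  rw [← mul_div_assoc, Finset.mul_sum]
  congr 1
  refine Finset.sum_congr rfl fun π _ => ?_
  have hN : ((2 * n + 1 : ℕ) : ℂ) ≠ 0 := Nat.cast_ne_zero.mpr (Nat.succ_ne_zero _)
  rw [← mul_pow]
  congr 1
  push_cast at hN ⊢
  rw [div_mul_div_comm, mul_comm, mul_div_mul_right _ _ hN]
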